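/- A ribbon graph $G$ is a (finite) surface with boundary written as the union of vertex-discs $V(G)$ and edge-ribbons $E(G)$ that meet in disjoint line segments, each lying on the boundary of exactly one vertex-disc and one edge-ribbon, every edge-ribbon containing exactly two of them (its ends, or half-edges). Loops, parallel edges and non-orientable surfaces are allowed. Let $F(G)$ be the set of boundary components and $c(G)$ the number of connected components of $G$; the Euler genus is $\varepsilon(G)=2c(G)-(|V(G)|-|E(G)|+|F(G)|)$. For $A\subseteq E(G)$ the partial Petrial $G^{\times|A}$ is obtained by detaching one end of each edge-ribbon in $A$, giving the ribbon a half-twist and reattaching the end. The partial Petrial polynomial is ${}^{\partial}\varepsilon^{\times}_{G}(z)=\sum_{A\subseteq E(G)}z^{\varepsilon(G^{\times|A})}$. If $e$ is an edge-ribbon joining two distinct vertex-discs $u,v$, then the contraction $G/e$ replaces $e,u,v$ by the single vertex-disc $e\cup u\cup v$. For a spanning tree $T$ of a connected ribbon graph $G$, $\mathrm{Aux}(G,T)$ is obtained from $G$ by contracting, one after the other in any order, all edge-ribbons of $T$. A bouquet is a ribbon graph with exactly one vertex-disc; its intersection graph $I(B)$ has vertex set $E(B)$, two distinct edges being adjacent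 when their half-edges alternate in the cyclic order around the vertex-disc. **Theorem.** Let $G$ be a connected ribbon graph with $n\ge 2$ vertices and let $T$ be any spanning tree of $G$. For $X\subseteq E(T)$ let $G_X=G^{\times|X}$. Then $E(T)$ has $2^{n-1}$ subsets $X$, each $\mathrm{Aux}(G_X,T)$ is a bouquet with edge set $E(G)\setminus E(T)$, and $$ {}^{\partial}\varepsilon^{\times}_{G}(z)=\sum_{X\subseteq E(T)}{}^{\partial}\varepsilon^{\times}_{\mathrm{Aux}(G_X,T)}(z)=\sum_{X\subseteq E(T)}\ \sum_{Y\subseteq E(G)\setminus E(T)} z^{\operatorname{rank}\left(\operatorname{adj}(I(\mathrm{Aux}(G_X,T)))+\mathbb D_Y\right)}, $$ where the rank is taken over $\mathrm{GF}(2)$, the matrices have rows and columns indexed by $E(G)\setminus E(T)$, and $\mathbb D_Y$ is the diagonal matrix whose $(i,i)$ entry is $1$ if $i\in Y$ and $0$ otherwise. -/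

import Mathlib

/-- The four corners of an edge-ribbon `e`, viewed as the square `[0,1] × [0,1]`: the corner
`(e, i, s)` lies on the end `{i} × [0,1]` (a line segment along which the ribbon meets a
vertex-disc; the pair `(e, i)` is a half-edge) and on the free side `[0,1] × {s}`. -/
abbrev Corner (α : Type*) := α × Bool × Bool

namespace Corner

/-- The other corner of the same end (half-edge). -/
def acrossEnd {α : Type*} (x : Corner α) : Corner α := (x.1, x.2.1, !x.2.2)

/-- The other corner of the same free side. -/
def alongSide {α : Type*} (x : Corner α) : Corner α := (x.1, !x.2.1, x.2.2)

/-- Exchange the two corners of the end `true` of every ribbon in `A`. -/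
def swapOn {α : Type*} [DecidableEq α] (A : Finset α) (x : Corner α) : Corner α :=
  if x.1 ∈ A ∧ x.2.1 = true then x.acrossEnd else x

@[simp] theorem acrossEnd_fst {α : Type*} (x : Corner α) : x.acrossEnd.1 = x.1 := rfl

@[simp] theorem alongSide_fst {α : Type*} (x : Corner α) : x.alongSide.1 = x.1 := rfl

@[simp] theorem alongSide_alongSide {α : Type*} (x : Corner α) :
    x.alongSide.alongSide = x := by
  simp [alongSide]

@[simp] theorem swapOn_fst {α : Type*} [DecidableEq α] (A : Finset α) (x : Corner α) :
    (swapOn A x).1 = x.1 := by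
  unfold swapOn; split_ifs <;> rfl

@[simp] theorem swapOn_swapOn {α : Type*} [DecidableEq α] (A : Finset α) (x : Corner α) :
    swapOn A (swapOn A x) = x := by
  obtain ⟨e, i, s⟩ := x
  by_cases h : e ∈ A <;> cases i <;> simp [swapOn, acrossEnd, h]

end Corner

/-- A finite ribbon graph (possibly non-orientable, loops and parallel edges allowed) with edges
labelled in `α`. The boundary circle of a vertex-disc that meets some edge-ribbon consists
alternately of ends of ribbons and of arcs running from a corner of one end to a corner of the
next end; `arc` sends each corner to the corner at the other extremity of its arc. Gluing discs
along the circles so described recovers the surface, with its vertex-discs and ribbons, up to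
homeomorphism. Corners over labels that are not edges are fixed by `arc`. The vertex-discs that
meet no ribbon are only counted. -/
structure RibbonGraph (α : Type*) where
  edges : Finset α
  arc : Corner α → Corner α
  arc_arc : ∀ x, arc (arc x) = x
  arc_eq_self_iff : ∀ x, arc x = x ↔ x.1 ∉ edges
  isolated : ℕ

namespace RibbonGraph

variable {α : Type*}

/-- The corners of the ribbons of `G`. -/
abbrev Corners (G : RibbonGraph α) : Type _ := {x : Corner α // x.1 ∈ G.edges}

/-- Vertex-discs: boundary circles made of ends and arcs, together with the discs that meet no
ribbon. -/
abbrev Vertex (G : RibbonGraph α) : Type _ :=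
  Quot (fun x y : G.Corners => y.1 = G.arc x.1 ∨ y.1 = x.1.acrossEnd) ⊕ Fin G.isolated

/-- Faces, that is boundary components of the surface: circles made of arcs and free sides,
together with the boundaries of the discs that meet no ribbon. -/
abbrev Face (G : RibbonGraph α) : Type _ :=
  Quot (fun x y : G.Corners => y.1 = G.arc x.1 ∨ y.1 = x.1.alongSide) ⊕ Fin G.isolated

/-- Connected components. -/
abbrev Component (G : RibbonGraph α) : Type _ :=
  Quot (fun x y : G.Corners =>
    y.1 = G.arc x.1 ∨ y.1 = x.1.acrossEnd ∨ y.1 = x.1.alongSide) ⊕ Fin G.isolated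

/-- The number `|V(G)|` of vertices. -/
noncomputable def numVertices (G : RibbonGraph α) : ℕ := Nat.card G.Vertex

/-- The number `|F(G)|` of faces. -/
noncomputable def numFaces (G : RibbonGraph α) : ℕ := Nat.card G.Face

/-- The number `c(G)` of connected components. -/
noncomputable def numComponents (G : RibbonGraph α) : ℕ := Nat.card G.Component

/-- `G` is connected (and not void). -/
def Connected (G : RibbonGraph α) : Prop := G.numComponents = 1

/-- A bouquet is a ribbon graph with exactly one vertex. -/
def IsBouquet (G : RibbonGraph α) : Prop := G.numVertices = 1

/-- The Euler characteristic `χ(G) = |V(G)| - |E(G)| + |F(G)|`. -/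
noncomputable def eulerChar (G : RibbonGraph α) : ℤ :=
  (G.numVertices : ℤ) - (G.edges.card : ℤ) + (G.numFaces : ℤ)

/-- The Euler genus `ε(G) = 2 c(G) - χ(G)`. -/
noncomputable def eulerGenus (G : RibbonGraph α) : ℤ :=
  2 * (G.numComponents : ℤ) - G.eulerChar

/-- The partial Petrial of `G` with respect to `A`: for each edge-ribbon in `A`, one of its ends is
detached, the ribbon is given a half-twist and the end is reattached, so that the two corners
of that end change places. -/
def petrial [DecidableEq α] (G : RibbonGraph α) (A : Finset α) : RibbonGraph α where
  edges := G.edges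
  arc x := Corner.swapOn A (G.arc (Corner.swapOn A x))
  arc_arc x := by simp [G.arc_arc]
  arc_eq_self_iff x := by
    rw [← Corner.swapOn_fst A x, ← G.arc_eq_self_iff]
    constructor
    · intro h
      rw [← Corner.swapOn_swapOn A (G.arc _), h]
    · intro h
      rw [h, Corner.swapOn_swapOn]
  isolated := G.isolated

/-- The partial Petrial polynomial, the sum of `z ^ ε` over all partial Petrials of `G`
(the Euler genus of a ribbon graph is never negative). -/
noncomputable def petrialPoly [DecidableEq α] (G : RibbonGraph α) : Polynomial ℤ :=
  ∑ A ∈ G.edges.powerset, Polynomial.X ^ (G.petrial A).eulerGenus.toNat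

/-- The vertex-disc to which the end `i` of the edge-ribbon `e` is attached. -/
def endVertex (G : RibbonGraph α) (e : G.edges) (i : Bool) : G.Vertex :=
  Sum.inl (Quot.mk _ ⟨(e.1, i, false), e.2⟩)

/-- The unordered pair of the vertices joined by the edge `e`. -/
def ends (G : RibbonGraph α) (e : G.edges) : Sym2 G.Vertex :=
  s(G.endVertex e false, G.endVertex e true)

/-- `T` is the edge set of a spanning tree of `G`: it has no loops and no parallel edges, and the
simple graph it forms on the set of all vertices of `G` is a tree. -/
structure IsSpanningTree (G : RibbonGraph α) (T : Finset α) : Prop where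
  subset : T ⊆ G.edges
  not_loop : ∀ e : G.edges, e.1 ∈ T → ¬ (G.ends e).IsDiag
  not_parallel : ∀ e f : G.edges, e.1 ∈ T → f.1 ∈ T → G.ends e = G.ends f → e = f
  isTree : (SimpleGraph.fromEdgeSet {p | ∃ e : G.edges, e.1 ∈ T ∧ G.ends e = p}).IsTree

/-- If the corner `y` belongs to the ribbon `e`, run along the free side of `e` through `y` and then
along the following arc; otherwise stay at `y`. -/
def passThrough [DecidableEq α] (G : RibbonGraph α) (e : α) (y : Corner α) : Corner α :=
  if y.1 = e then G.arc y.alongSide else y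

theorem passThrough_of_ne [DecidableEq α] (G : RibbonGraph α) {e : α} {y : Corner α}
    (h : y.1 ≠ e) : G.passThrough e y = y := if_neg h

theorem passThrough_of_eq [DecidableEq α] (G : RibbonGraph α) {e : α} {y : Corner α}
    (h : y.1 = e) : G.passThrough e y = G.arc y.alongSide := if_pos h

/-- Extremity of the arc issuing from the corner `x` in the contraction of `e`. -/
def contractArc [DecidableEq α] (G : RibbonGraph α) (e : α) (x : Corner α) : Corner α :=
  if x.1 = e then x else G.passThrough e (G.passThrough e (G.arc x))

theorem mem_of_arc_ne (G : RibbonGraph α) {x : Corner α} (h : G.arc x ≠ x) : x.1 ∈ G.edges := by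
  by_contra h'
  exact h ((G.arc_eq_self_iff x).2 h')

theorem alongSide_ne (x : Corner α) : x.alongSide ≠ x := by
  obtain ⟨e, i, s⟩ := x
  simp [Corner.alongSide]

theorem fst_eq_cases {y z w : Corner α} (hz : z.1 = y.1) (hw : w.1 = y.1)
    (h1 : z ≠ y) (h2 : z ≠ y.alongSide) :
    w = y ∨ w = y.alongSide ∨ w = z ∨ w = z.alongSide := by
  obtain ⟨e, i, s⟩ := y
  obtain ⟨f, j, t⟩ := z
  obtain ⟨g, k, u⟩ := w
  obtain rfl : f = e := hz
  obtain rfl : g = f := hw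
  cases i <;> cases j <;> cases k <;> cases s <;> cases t <;> cases u <;>
    simp_all [Corner.alongSide]

theorem contractArc_spec [DecidableEq α] (G : RibbonGraph α) (e : α) (x : Corner α)
    (hx : x.1 ≠ e) : (G.contractArc e x).1 ≠ e ∧
      G.contractArc e (G.contractArc e x) = x ∧
      (G.contractArc e x = x ↔ x.1 ∉ G.edges) := by
  have aa := G.arc_arc
  have ne_of : ∀ y : Corner α, y.1 ∈ G.edges → G.arc y ≠ y := fun y hy h =>
    (G.arc_eq_self_iff y).1 h hy
  by_cases hxm : x.1 ∈ G.edges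
  · suffices h : (G.contractArc e x).1 ≠ e ∧ G.contractArc e (G.contractArc e x) = x ∧
        G.contractArc e x ≠ x from ⟨h.1, h.2.1, fun h' => absurd h' h.2.2, fun h' => absurd hxm h'⟩
    obtain ⟨y, hy⟩ : ∃ y, y = G.arc x := ⟨_, rfl⟩
    have hxy : G.arc y = x := by rw [hy, aa]
    have hyx : y ≠ x := fun h => ne_of x hxm (by rw [← hy, h])
    have hym : y.1 ∈ G.edges := G.mem_of_arc_ne (by rw [hxy]; exact hyx.symm)
    by_cases hye : y.1 = e
    · obtain ⟨z, hz⟩ : ∃ z, z = G.arc y.alongSide := ⟨_, rfl⟩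
      have hzy : G.arc z = y.alongSide := by rw [hz, aa]
      have e1 : G.contractArc e x = G.passThrough e z := by
        rw [contractArc, if_neg hx, ← hy, G.passThrough_of_eq hye, ← hz]
      by_cases hze : z.1 = e
      · obtain ⟨w, hw⟩ : ∃ w, w = G.arc z.alongSide := ⟨_, rfl⟩
        have hwz : G.arc w = z.alongSide := by rw [hw, aa]
        have e2 : G.contractArc e x = w := by rw [e1, G.passThrough_of_eq hze, ← hw]
        have h1 : z ≠ y := by
          intro h
          apply hx
          rw [← hxy, ← h, hzy]; exact hye
        have h2 : z ≠ y.alongSide := by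
          intro h
          exact ne_of y.alongSide hym (by rw [← hz, h])
        have hwe : w.1 ≠ e := by
          intro hwe
          rcases fst_eq_cases (hze.trans hye.symm) (hwe.trans hye.symm) h1 h2 with h | h | h | h
          · apply hx
            rw [← hxy, ← h, hwz]; exact hze
          · rw [h, ← hz] at hwz
            exact alongSide_ne z hwz.symm
          · rw [h, hzy] at hwz
            apply h1
            rw [← Corner.alongSide_alongSide z, ← hwz, Corner.alongSide_alongSide]
          · refine ne_of z.alongSide ?_ (by rw [← hw, h])
            rw [Corner.alongSide_fst, hze, ← hye]; exact hym
        refine ⟨by rw [e2]; exact hwe, ?_, ?_⟩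
        · rw [e2, contractArc, if_neg hwe, hwz, G.passThrough_of_eq (y := z.alongSide) hze,
            Corner.alongSide_alongSide, hzy, G.passThrough_of_eq (y := y.alongSide) hye,
            Corner.alongSide_alongSide, hxy]
        · rw [e2]
          intro h
          rw [h, ← hy] at hwz
          apply h2
          rw [hwz, Corner.alongSide_alongSide]
      · have e2 : G.contractArc e x = z := by rw [e1, G.passThrough_of_ne hze]
        refine ⟨by rw [e2]; exact hze, ?_, ?_⟩
        · rw [e2, contractArc, if_neg hze, hzy, G.passThrough_of_eq (y := y.alongSide) hye,
            Corner.alongSide_alongSide, hxy, G.passThrough_of_ne hx]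
        · rw [e2]
          intro h
          rw [h, ← hy] at hzy
          exact alongSide_ne y hzy.symm
    · have e1 : G.contractArc e x = y := by
        rw [contractArc, if_neg hx, ← hy, G.passThrough_of_ne hye, G.passThrough_of_ne hye]
      refine ⟨by rw [e1]; exact hye, ?_, by rw [e1]; exact hyx⟩
      rw [e1, contractArc, if_neg hye, hxy, G.passThrough_of_ne hx, G.passThrough_of_ne hx]
  · have e1 : G.contractArc e x = x := by
      rw [contractArc, if_neg hx, (G.arc_eq_self_iff x).2 hxm, G.passThrough_of_ne hx,
        G.passThrough_of_ne hx]
    exact ⟨by rw [e1]; exact hx, by rw [e1, e1], fun _ => hxm, fun _ => e1⟩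

/-- The contraction `G/e` of an edge-ribbon `e` joining two distinct vertex-discs `u` and `v`
(the operation is used only for such `e`): `e`, `u`, `v` are replaced by the single vertex-disc
`e ∪ u ∪ v`. An arc of its boundary runs along the boundary of `u ∪ v` and, each time it reaches
a corner of `e`, continues along the free side of `e`, which can happen at most twice (once for
each side of `e`) before the end of another ribbon is reached. The disc `e ∪ u ∪ v` meets no
ribbon exactly when `e` has the only end on `u` and the only end on `v`. -/
def contract [DecidableEq α] (G : RibbonGraph α) (e : α) : RibbonGraph α where
  edges := G.edges.erase e
  arc := G.contractArc e
  arc_arc x := by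
    by_cases hx : x.1 = e
    · have : G.contractArc e x = x := if_pos hx
      rw [this, this]
    · exact (G.contractArc_spec e x hx).2.1
  arc_eq_self_iff x := by
    by_cases hx : x.1 = e
    · have : G.contractArc e x = x := if_pos hx
      simp [this, hx]
    · rw [(G.contractArc_spec e x hx).2.2]
      simp [hx]
  isolated := G.isolated +
    if ∀ i s : Bool, G.arc (e, i, s) = Corner.acrossEnd (e, i, s) then 1 else 0

/-- The auxiliary bouquet `Aux(G,T)`: all the edges of the spanning tree `T` are contracted, one
after the other, in the order in which the list `l` enumerates them. -/
def aux [DecidableEq α] (G : RibbonGraph α) (l : List α) : RibbonGraph α :=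
  l.foldl contract G

/-- The next corner met when going around a vertex-disc: cross the end at `x`, then follow the arc.
Until it closes up, this walk visits every end on the vertex-disc exactly once, in the cyclic
order of the rotation. -/
def next (G : RibbonGraph α) (x : Corner α) : Corner α := G.arc x.acrossEnd

/-- The half-edges of `a` and `b` alternate in the rotation: going once around the vertex-disc
from an end of `a` one meets `a, b, a, b` in this cyclic order. -/
def Interlaced (G : RibbonGraph α) (a b : α) : Prop :=
  ∃ (x : Corner α) (i j k : ℕ), 0 < i ∧ i < j ∧ j < k ∧ k < Function.minimalPeriod G.next x ∧
    x.1 = a ∧ (G.next^[i] x).1 = b ∧ (G.next^[j] x).1 = a ∧ (G.next^[k] x).1 = b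

/-- The intersection graph `I(B)` of a bouquet: distinct loops are adjacent when interlaced. -/
def intersectionGraph (B : RibbonGraph α) : SimpleGraph B.edges :=
  SimpleGraph.fromRel (fun a b => B.Interlaced a.1 b.1)

open Classical in
/-- The adjacency matrix over `GF(2)` of the intersection graph. -/
noncomputable def adjI (B : RibbonGraph α) : Matrix B.edges B.edges (ZMod 2) :=
  B.intersectionGraph.adjMatrix (ZMod 2)

/-- The diagonal matrix `D_Y`, with entry `1` at the edges in `Y` and `0` at the others. -/
def diagOf [DecidableEq α] (B : RibbonGraph α) (Y : Finset α) :
    Matrix B.edges B.edges (ZMod 2) :=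
  Matrix.diagonal (fun e => if e.1 ∈ Y then 1 else 0)

end RibbonGraph

/-! Write each `A ⊆ E(G)` as `X ∪ Y` with `X ⊆ E(T)` and `Y` disjoint from `E(T)`. Half-twists do
not affect which ends lie on which vertex-disc, so `T` still spans `G^{×|A}` (`Spans.petrial`).
Contracting a non-loop merges two vertices and deletes one edge, and preserves the numbers of faces
and components, hence the Euler genus (`Nonloop.eulerGenus_contract`). Twisting `Y` commutes with
contracting `T` (`aux_petrial`), so `G^{×|X ∪ Y}` has the Euler genus of `Aux(G_X,T)^{×|Y}`. Summing
over `Y`, then `X`, gives the first formula.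

There remains a bouquet `B`. For each edge `b` let `φ_b` be a `GF(2)`-valued function on the
boundary circle of the vertex-disc which jumps exactly at the two ends of `b`. The matrix `M` with
entries `φ_b(one end of a) + φ_b(other end of a)`, read along a free side of `a`, has off-diagonal
part the adjacency matrix of `I(B)`, as `a` and `b` alternate iff `φ_b` separates the ends of `a`
(`IsPotential.interlaced_iff`). A function on the faces is determined, up to a constant, by its
variations `ψ` across the edges, and `ψ` occurs iff `∑ ψ_b φ_b` takes equal values at the two
extremities of each free side, that is `M ψ = 0` (`range_faceVariation`). So `|F| - 1 = |E| - rank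
M`, and the Euler genus is `rank M` (`eulerGenus_eq_rank`). Twisting `Y` adds `D_Y` to `M`
(`potentialMatrix_petrial`); the diagonal that `M` had at the start is absorbed by reindexing `Y`
with a symmetric difference.

Vertices, faces and components are all counted by `numClasses S T`, where `S` and `T` say which ends
and which free sides link corners. -/

/-- Enlarging a relation by identifications between the classes of two points `a` and `b` that were
not yet identified lowers the number of classes by exactly one. -/
theorem card_quot_add_one_of_merge {X : Type*} [Finite X] {r r' : X → X → Prop} {a b : X}
    (h1 : ∀ x y, r x y → Quot.mk r' x = Quot.mk r' y) (h2 : Quot.mk r' a = Quot.mk r' b)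
    (h3 : ∀ x y, r' x y → Quot.mk r x = Quot.mk r y ∨
      (Quot.mk r x = Quot.mk r a ∧ Quot.mk r y = Quot.mk r b) ∨
      (Quot.mk r x = Quot.mk r b ∧ Quot.mk r y = Quot.mk r a))
    (hab : Quot.mk r a ≠ Quot.mk r b) : Nat.card (Quot r') + 1 = Nat.card (Quot r) := by
  classical
  let g : Quot r → {q : Quot r // q ≠ Quot.mk r b} := fun q =>
    if h : q = Quot.mk r b then ⟨Quot.mk r a, hab⟩ else ⟨q, h⟩
  have hg : g (Quot.mk r a) = g (Quot.mk r b) := by simp [g, hab]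
  let F : Quot r' → {q : Quot r // q ≠ Quot.mk r b} :=
    Quot.lift (fun x => g (Quot.mk r x)) (by
      intro x y h
      rcases h3 x y h with h | ⟨h, h'⟩ | ⟨h, h'⟩
      · simp only [h]
      · simp only [h, h', hg]
      · simp only [h, h', hg])
  let K : Quot r → Quot r' := Quot.lift (fun x => Quot.mk r' x) h1
  have e : Quot r' ≃ {q : Quot r // q ≠ Quot.mk r b} :=
    { toFun := F
      invFun := fun q => K q.1
      left_inv := by
        rintro ⟨x⟩
        change K (g (Quot.mk r x)).1 = Quot.mk r' x
        by_cases h : Quot.mk r x = Quot.mk r b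
        · have : Quot.mk r' x = Quot.mk r' b := congrArg K h
          simp only [g, h, dif_pos]
          rw [this]
          exact h2
        · simp only [g, dif_neg h]; rfl
      right_inv := by
        rintro ⟨⟨x⟩, hx⟩
        change g (Quot.mk r x) = _
        simp only [g]
        rw [dif_neg hx] }
  rw [Nat.card_congr e, ← Nat.card_congr (Equiv.optionSubtypeNe (Quot.mk r b)), Finite.card_option]

/-- Two relations that generate the same equivalence have equally many classes. -/
theorem card_quot_congr {X : Type*} {r r' : X → X → Prop}
    (h1 : ∀ x y, r x y → Quot.mk r' x = Quot.mk r' y)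
    (h2 : ∀ x y, r' x y → Quot.mk r x = Quot.mk r y) :
    Nat.card (Quot r) = Nat.card (Quot r') :=
  Nat.card_congr
    { toFun := Quot.lift (Quot.mk r') h1
      invFun := Quot.lift (Quot.mk r) h2
      left_inv := by rintro ⟨x⟩; rfl
      right_inv := by rintro ⟨x⟩; rfl }

/-! ### Corners and half-twists -/

namespace Corner

variable {α : Type*}

@[simp] theorem acrossEnd_acrossEnd (x : Corner α) : x.acrossEnd.acrossEnd = x := by
  simp [acrossEnd]

theorem acrossEnd_ne (x : Corner α) : x.acrossEnd ≠ x := by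
  obtain ⟨e, i, s⟩ := x
  simp [acrossEnd]

variable [DecidableEq α]

theorem swapOn_of_notMem {A : Finset α} {x : Corner α} (h : x.1 ∉ A) : swapOn A x = x :=
  if_neg fun h' => h h'.1

theorem swapOn_eq_or (A : Finset α) (x : Corner α) :
    swapOn A x = x ∨ swapOn A x = x.acrossEnd := by
  unfold swapOn; split_ifs <;> simp

theorem swapOn_acrossEnd (A : Finset α) (x : Corner α) :
    swapOn A x.acrossEnd = (swapOn A x).acrossEnd := by
  obtain ⟨e, i, s⟩ := x
  by_cases h : e ∈ A <;> cases i <;> simp [swapOn, acrossEnd, h]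

theorem swapOn_union {A B : Finset α} (h : Disjoint A B) (x : Corner α) :
    swapOn (A ∪ B) x = swapOn B (swapOn A x) := by
  obtain ⟨e, i, s⟩ := x
  have : e ∈ A → e ∉ B := fun h' => Finset.disjoint_left.1 h h'
  by_cases hA : e ∈ A <;> by_cases hB : e ∈ B <;> cases i <;>
    simp_all [swapOn, acrossEnd]

end Corner

/-! ### Vertices, faces and components as classes of linked corners -/

namespace RibbonGraph

variable {α : Type*}

instance (G : RibbonGraph α) : Finite G.Corners :=
  Finite.of_injective (β := G.edges × Bool × Bool) (fun x => (⟨x.1.1, x.2⟩, x.1.2)) (by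
    rintro ⟨⟨a, b⟩, h⟩ ⟨⟨c, d⟩, h'⟩ hh
    simp_all)

theorem arc_ne (G : RibbonGraph α) {x : Corner α} (hx : x.1 ∈ G.edges) : G.arc x ≠ x :=
  fun h => (G.arc_eq_self_iff x).1 h hx

theorem arc_mem (G : RibbonGraph α) {x : Corner α} (hx : x.1 ∈ G.edges) :
    (G.arc x).1 ∈ G.edges :=
  G.mem_of_arc_ne (by rw [G.arc_arc]; exact (G.arc_ne hx).symm)

/-- Two corners are linked if they are the extremities of an arc, or of an end of an edge in `S`, or
of a free side of an edge in `T`. -/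
def link (G : RibbonGraph α) (S T : Set α) (x y : G.Corners) : Prop :=
  y.1 = G.arc x.1 ∨ (x.1.1 ∈ S ∧ y.1 = x.1.acrossEnd) ∨ (x.1.1 ∈ T ∧ y.1 = x.1.alongSide)

/-- The class of a corner for the equivalence generated by `link`. -/
def cls (G : RibbonGraph α) (S T : Set α) (x : Corner α) (hx : x.1 ∈ G.edges) :
    Quot (G.link S T) := Quot.mk _ ⟨x, hx⟩

/-- The number of classes of `link`, each isolated vertex counting for one. -/
noncomputable def numClasses (G : RibbonGraph α) (S T : Set α) : ℕ :=
  Nat.card (Quot (G.link S T)) + G.isolated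

section cls

variable (G : RibbonGraph α) {S T S' T' : Set α} {x y : Corner α}

theorem cls_arc (hx : x.1 ∈ G.edges) : G.cls S T (G.arc x) (G.arc_mem hx) = G.cls S T x hx :=
  (Quot.sound (r := G.link S T) (Or.inl rfl)).symm

theorem cls_acrossEnd (hx : x.1 ∈ G.edges) (hS : x.1 ∈ S) :
    G.cls S T x.acrossEnd hx = G.cls S T x hx :=
  (Quot.sound (r := G.link S T) (Or.inr (Or.inl ⟨hS, rfl⟩))).symm

theorem cls_alongSide (hx : x.1 ∈ G.edges) (hT : x.1 ∈ T) :
    G.cls S T x.alongSide hx = G.cls S T x hx :=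
  (Quot.sound (r := G.link S T) (Or.inr (Or.inr ⟨hT, rfl⟩))).symm

theorem cls_congr (hx : x.1 ∈ G.edges) (h : y = x) :
    G.cls S T y (h ▸ hx) = G.cls S T x hx := by
  subst h; rfl

theorem cls_eq_of_cls_eq (h : ∀ x y : G.Corners, G.link S T x y →
    G.cls S' T' x.1 x.2 = G.cls S' T' y.1 y.2) {hx : x.1 ∈ G.edges} {hy : y.1 ∈ G.edges}
    (hxy : G.cls S T x hx = G.cls S T y hy) : G.cls S' T' x hx = G.cls S' T' y hy :=
  congrArg (Quot.lift (fun x : G.Corners => G.cls S' T' x.1 x.2) h) hxy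

theorem cls_mono (hS : S ⊆ S') (hT : T ⊆ T') {hx : x.1 ∈ G.edges} {hy : y.1 ∈ G.edges}
    (hxy : G.cls S T x hx = G.cls S T y hy) : G.cls S' T' x hx = G.cls S' T' y hy := by
  refine G.cls_eq_of_cls_eq (fun x y h => Quot.sound ?_) hxy
  rcases h with h | ⟨h, h'⟩ | ⟨h, h'⟩
  · exact Or.inl h
  · exact Or.inr (Or.inl ⟨hS h, h'⟩)
  · exact Or.inr (Or.inr ⟨hT h, h'⟩)

end cls

theorem numVertices_eq (G : RibbonGraph α) : G.numVertices = G.numClasses Set.univ ∅ := by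
  have : (fun x y : G.Corners => y.1 = G.arc x.1 ∨ y.1 = x.1.acrossEnd) =
      G.link Set.univ ∅ := by
    funext x y; simp [link]
  rw [numVertices, Vertex, this, Nat.card_sum, Nat.card_fin, numClasses]

theorem numFaces_eq (G : RibbonGraph α) : G.numFaces = G.numClasses ∅ Set.univ := by
  have : (fun x y : G.Corners => y.1 = G.arc x.1 ∨ y.1 = x.1.alongSide) =
      G.link ∅ Set.univ := by
    funext x y; simp [link]
  rw [numFaces, Face, this, Nat.card_sum, Nat.card_fin, numClasses]

theorem numComponents_eq (G : RibbonGraph α) :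
    G.numComponents = G.numClasses Set.univ Set.univ := by
  have : (fun x y : G.Corners =>
      y.1 = G.arc x.1 ∨ y.1 = x.1.acrossEnd ∨ y.1 = x.1.alongSide) =
      G.link Set.univ Set.univ := by
    funext x y; simp [link]
  rw [numComponents, Component, this, Nat.card_sum, Nat.card_fin, numClasses]

/-- `numClasses` depends only on the edges of `G` in `S` and `T`. -/
theorem numClasses_congr (G : RibbonGraph α) {S T S' T' : Set α}
    (hS : ∀ e ∈ G.edges, e ∈ S ↔ e ∈ S') (hT : ∀ e ∈ G.edges, e ∈ T ↔ e ∈ T') :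
    G.numClasses S T = G.numClasses S' T' := by
  have : G.link S T = G.link S' T' := by
    funext x y
    simp only [link, hS _ x.2, hT _ x.2]
  rw [numClasses, this, numClasses]


/-! ### Edges that are not loops, and the effect of one edge on the classes -/

/-- The edge `e` joins two distinct vertices. -/
def Nonloop (G : RibbonGraph α) (e : α) : Prop :=
  ∃ he : e ∈ G.edges, G.cls Set.univ ∅ (e, false, false) he ≠ G.cls Set.univ ∅ (e, true, false) he

theorem cls_eq_of_end (G : RibbonGraph α) {S T : Set α} {e : α} (hS : e ∈ S)
    (he : e ∈ G.edges) (i s t : Bool) : G.cls S T (e, i, s) he = G.cls S T (e, i, t) he := by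
  by_cases h : t = s
  · subst h; rfl
  · obtain rfl : t = !s := by cases s <;> cases t <;> simp_all
    exact (G.cls_acrossEnd (x := (e, i, s)) he hS).symm

theorem Nonloop.cls_ne {G : RibbonGraph α} {e : α} (h : G.Nonloop e) (he : e ∈ G.edges)
    (i s t : Bool) : G.cls Set.univ ∅ (e, i, s) he ≠ G.cls Set.univ ∅ (e, !i, t) he := by
  obtain ⟨_, h⟩ := h
  rw [G.cls_eq_of_end (Set.mem_univ _) he i s false, G.cls_eq_of_end (Set.mem_univ _) he (!i) t false]
  cases i
  · exact h
  · exact h.symm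

/-- An arc between two corners of an edge that is not a loop joins corners of the same end. -/
theorem Nonloop.arc_eq {G : RibbonGraph α} {e : α} (h : G.Nonloop e) {x : Corner α}
    (hx : x.1 = e) (hax : (G.arc x).1 = e) : G.arc x = x.acrossEnd := by
  obtain ⟨e', i, s⟩ := x
  obtain rfl : e' = e := hx
  have he : e' ∈ G.edges := h.1
  obtain ⟨j, t, hjt⟩ : ∃ j t, G.arc (e', i, s) = (e', j, t) :=
    ⟨_, _, Prod.ext hax rfl⟩
  have h1 := G.cls_arc (S := Set.univ) (T := ∅) (x := (e', i, s)) he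
  have h2 := G.arc_ne (x := (e', i, s)) he
  by_cases hij : j = i
  · subst hij
    rw [hjt] at h2 ⊢
    have : t = !s := by cases s <;> cases t <;> simp_all
    rw [this]; rfl
  · obtain rfl : j = !i := by cases i <;> cases j <;> simp_all
    exfalso
    simp only [hjt] at h1
    exact h.cls_ne he i s t h1.symm

/-- Every vertex circle through an edge that is not a loop stays in one piece when the end of that
edge on it is removed, since otherwise one of the two pieces would have a single extremity. -/
theorem Nonloop.cls_end_eq {G : RibbonGraph α} {e : α} (h : G.Nonloop e) (he : e ∈ G.edges)
    (i : Bool) : G.cls {e}ᶜ ∅ (e, i, false) he = G.cls {e}ᶜ ∅ (e, i, true) he := by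
  classical
  have := Fintype.ofFinite G.Corners
  by_contra hne
  let C : Finset G.Corners := Finset.univ.filter fun x =>
    G.cls {e}ᶜ ∅ x.1 x.2 = G.cls {e}ᶜ ∅ (e, i, false) he
  have hC : ∀ x, x ∈ C ↔ G.cls {e}ᶜ ∅ x.1 x.2 = G.cls {e}ᶜ ∅ (e, i, false) he := by
    intro x; simp [C]
  -- Parity count: arcs pair off all the corners of `C`, and ends pair off those not on `e`, so
  -- evenly many corners of `C` lie on `e`; yet `h3` finds exactly one.
  have h1 : ∑ x ∈ C, (1 : ZMod 2) = 0 := by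
    refine Finset.sum_involution (fun x _ => ⟨G.arc x.1, G.arc_mem x.2⟩) ?_ ?_ ?_ ?_
    · intros; decide
    · intro x _ _ h
      exact G.arc_ne x.2 (congrArg Subtype.val h)
    · intro x hx
      rw [hC] at hx ⊢
      rw [← hx]
      exact G.cls_arc x.2
    · intro x _
      exact Subtype.ext (G.arc_arc _)
  have h2 : ∑ x ∈ C.filter (fun x => ¬ x.1.1 = e), (1 : ZMod 2) = 0 := by
    refine Finset.sum_involution (fun x _ => ⟨x.1.acrossEnd, x.2⟩) ?_ ?_ ?_ ?_
    · intros; decide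
    · intro x _ _ h
      exact x.1.acrossEnd_ne (congrArg Subtype.val h)
    · intro x hx
      rw [Finset.mem_filter, hC] at hx ⊢
      refine ⟨?_, hx.2⟩
      rw [← hx.1]
      exact G.cls_acrossEnd x.2 hx.2
    · intro x _
      exact Subtype.ext x.1.acrossEnd_acrossEnd
  have h3 : C.filter (fun x => x.1.1 = e) = {⟨(e, i, false), he⟩} := by
    ext ⟨⟨f, j, s⟩, hf⟩
    simp only [Finset.mem_filter, hC, Finset.mem_singleton, Subtype.mk.injEq, Prod.mk.injEq]
    constructor
    · rintro ⟨hx, rfl⟩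
      have hij : j = i := by
        by_contra hij
        obtain rfl : j = !i := by cases i <;> cases j <;> simp_all
        exact h.cls_ne he i false s (G.cls_mono (Set.subset_univ _) (le_refl _) hx).symm
      subst hij
      refine ⟨rfl, rfl, ?_⟩
      cases s
      · rfl
      · exact absurd hx.symm hne
    · rintro ⟨rfl, rfl, rfl⟩
      exact ⟨rfl, rfl⟩
  rw [← Finset.sum_filter_add_sum_filter_not C (fun x => x.1.1 = e), h2, h3] at h1
  simp at h1

/-- The links across the ends of `e` are redundant: by `Nonloop.cls_end_eq` the rest of the vertex
circle already joins the two corners of each end. This gives the hypothesis `e ∉ S` needed for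
contraction. -/
theorem Nonloop.numClasses_compl {G : RibbonGraph α} {e : α} (h : G.Nonloop e) (T : Set α) :
    G.numClasses Set.univ T = G.numClasses {e}ᶜ T := by
  rw [numClasses, numClasses]
  congr 1
  apply card_quot_congr
  · rintro ⟨x, hx⟩ ⟨y, hy⟩ (hh | ⟨_, hh⟩ | hh)
    · exact Quot.sound (Or.inl hh)
    · by_cases hxe : x.1 = e
      · obtain rfl : y = x.acrossEnd := hh
        obtain ⟨f, i, s⟩ := x
        obtain rfl : f = e := hxe
        have := G.cls_mono (le_refl _) (Set.empty_subset T) (h.cls_end_eq hx i)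
        cases s
        · exact this
        · exact this.symm
      · exact Quot.sound (Or.inr (Or.inl ⟨hxe, hh⟩))
    · exact Quot.sound (Or.inr (Or.inr hh))
  · rintro ⟨x, hx⟩ ⟨y, hy⟩ (hh | ⟨_, hh⟩ | hh)
    · exact Quot.sound (Or.inl hh)
    · exact Quot.sound (Or.inr (Or.inl ⟨trivial, hh⟩))
    · exact Quot.sound (Or.inr (Or.inr hh))

/-- The only new links are the two free sides of `e`. Since all ends link their corners, both sides
join the same pair of classes, and there is a single merge. -/
theorem numClasses_insert_add_one (G : RibbonGraph α) {e : α} {T : Set α} (he : e ∈ G.edges)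
    (h : G.cls Set.univ T (e, false, false) he ≠ G.cls Set.univ T (e, true, false) he) :
    G.numClasses Set.univ (insert e T) + 1 = G.numClasses Set.univ T := by
  rw [numClasses, numClasses, add_right_comm]
  congr 1
  refine card_quot_add_one_of_merge (a := ⟨(e, false, false), he⟩) (b := ⟨(e, true, false), he⟩)
    ?_ ?_ ?_ h
  · intro x y hxy
    have : G.cls Set.univ T x.1 x.2 = G.cls Set.univ T y.1 y.2 := Quot.sound hxy
    exact G.cls_mono (le_refl _) (Set.subset_insert _ _) this
  · exact (G.cls_alongSide (S := Set.univ) (x := (e, false, false)) he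
      (Set.mem_insert e T)).symm
  · rintro ⟨x, hx⟩ ⟨y, hy⟩ (hh | hh | ⟨hT, hh⟩)
    · exact Or.inl (Quot.sound (Or.inl hh))
    · exact Or.inl (Quot.sound (Or.inr (Or.inl hh)))
    · by_cases hxe : x.1 = e
      · right
        obtain rfl : y = x.alongSide := hh
        obtain ⟨f, i, s⟩ := x
        obtain rfl : f = e := hxe
        cases i
        · exact Or.inl ⟨G.cls_eq_of_end (Set.mem_univ _) hx _ _ _, G.cls_eq_of_end (Set.mem_univ _) hx _ _ _⟩
        · exact Or.inr ⟨G.cls_eq_of_end (Set.mem_univ _) hx _ _ _, G.cls_eq_of_end (Set.mem_univ _) hx _ _ _⟩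
      · exact Or.inl (Quot.sound (Or.inr (Or.inr ⟨hT.resolve_left hxe, hh⟩)))

theorem numClasses_insert_of_cls_eq (G : RibbonGraph α) {e : α} {T : Set α} (he : e ∈ G.edges)
    (h : G.cls Set.univ T (e, false, false) he = G.cls Set.univ T (e, true, false) he) :
    G.numClasses Set.univ (insert e T) = G.numClasses Set.univ T := by
  rw [numClasses, numClasses]
  congr 1
  apply card_quot_congr
  · rintro ⟨x, hx⟩ ⟨y, hy⟩ (hh | hh | ⟨hT, hh⟩)
    · exact Quot.sound (Or.inl hh)
    · exact Quot.sound (Or.inr (Or.inl hh))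
    · by_cases hxe : x.1 = e
      · obtain rfl : y = x.alongSide := hh
        obtain ⟨f, i, s⟩ := x
        obtain rfl : f = e := hxe
        change G.cls Set.univ T (f, i, s) hx = G.cls Set.univ T (f, !i, s) hx
        rw [G.cls_eq_of_end (Set.mem_univ _) hx i s false, G.cls_eq_of_end (Set.mem_univ _) hx (!i) s false]
        cases i
        · exact h
        · exact h.symm
      · exact Quot.sound (Or.inr (Or.inr ⟨hT.resolve_left hxe, hh⟩))
  · intro x y hxy
    have : G.cls Set.univ T x.1 x.2 = G.cls Set.univ T y.1 y.2 := Quot.sound hxy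
    exact G.cls_mono (le_refl _) (Set.subset_insert _ _) this

/-- Each edge merges at most two classes. -/
theorem numClasses_le_add_card (G : RibbonGraph α) (T : Finset α) (hT : T ⊆ G.edges) :
    G.numClasses Set.univ ∅ ≤ G.numClasses Set.univ T + T.card := by
  classical
  induction T using Finset.induction_on with
  | empty => simp
  | insert e T heT ih =>
    have ih := ih ((Finset.subset_insert _ _).trans hT)
    have he : e ∈ G.edges := hT (Finset.mem_insert_self _ _)
    rw [Finset.card_insert_of_notMem heT, Finset.coe_insert]
    by_cases h : G.cls Set.univ T (e, false, false) he = G.cls Set.univ T (e, true, false) he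
    · rw [G.numClasses_insert_of_cls_eq he h]; omega
    · have := G.numClasses_insert_add_one he h
      omega

/-! ### Contraction of an edge -/

section contract

variable [DecidableEq α]

theorem cls_passThrough (G : RibbonGraph α) {S T : Set α} {e : α} (heT : e ∈ T) {y : Corner α}
    (hy : y.1 ∈ G.edges) : ∃ h : (G.passThrough e y).1 ∈ G.edges,
      G.cls S T (G.passThrough e y) h = G.cls S T y hy := by
  by_cases hye : y.1 = e
  · rw [G.passThrough_of_eq hye]
    exact ⟨G.arc_mem hy, (G.cls_arc (x := y.alongSide) hy).trans
      (G.cls_alongSide hy (hye ▸ heT))⟩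
  · rw [G.passThrough_of_ne hye]
    exact ⟨hy, rfl⟩

/-- The classes of the contraction are those of `G`, when the free sides of `e` but not its ends are
used to link corners, except that a component consisting of `e` alone becomes an isolated vertex. -/
theorem Nonloop.numClasses_contract {G : RibbonGraph α} {e : α} (h : G.Nonloop e) {S T : Set α}
    (heS : e ∉ S) (heT : e ∈ T) : G.numClasses S T = (G.contract e).numClasses S T := by
  have he : e ∈ G.edges := h.1
  let H := G.contract e
  let I : Prop := ∀ i s : Bool, G.arc (e, i, s) = Corner.acrossEnd (e, i, s)
  have hmem : ∀ {x : Corner α}, x.1 ∈ G.edges → x.1 ≠ e → x.1 ∈ H.edges :=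
    fun hx hxe => Finset.mem_erase.2 ⟨hxe, hx⟩
  -- An arc from `e` to `e` closes up one end, by `Nonloop.arc_eq`; arcs at both extremities of a
  -- free side close up both ends, and then `e` is a whole component.
  have hI : ∀ {x : Corner α}, x.1 = e → (G.arc x).1 = e → (G.arc x.alongSide).1 = e → I := by
    rintro ⟨f, i, s⟩ hx h1 h2
    obtain rfl : f = e := hx
    have h3 := h.arc_eq rfl h1
    have h4 := h.arc_eq (x := Corner.alongSide (f, i, s)) rfl h2
    have h5 : G.arc (f, i, !s) = (f, i, s) := by
      have := congrArg G.arc h3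
      rw [G.arc_arc] at this
      exact this.symm
    have h6 : G.arc (f, !i, !s) = (f, !i, s) := by
      have := congrArg G.arc h4
      rw [G.arc_arc] at this
      exact this.symm
    intro j t
    cases i <;> cases s <;> cases j <;> cases t <;>
      simp_all [Corner.acrossEnd, Corner.alongSide]
  have harc : ∀ {x : Corner α}, x.1 ≠ e →
      H.arc x = G.passThrough e (G.passThrough e (G.arc x)) := fun hx => if_neg hx
  -- A corner of `e` slides off `e` along its arc or, if that returns to `e`, along the arc at the
  -- other extremity of its free side. When both return to `e`, it goes to the extra point, which
  -- stands for the new isolated vertex.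
  let r : G.Corners → Quot (H.link S T) ⊕ PLift I := fun x =>
    if h0 : x.1.1 ≠ e then Sum.inl (H.cls S T x.1 (hmem x.2 h0))
    else if h1 : (G.arc x.1).1 ≠ e then Sum.inl (H.cls S T (G.arc x.1) (hmem (G.arc_mem x.2) h1))
    else if h2 : (G.arc x.1.alongSide).1 ≠ e then
      Sum.inl (H.cls S T (G.arc x.1.alongSide) (hmem (G.arc_mem (x := x.1.alongSide) x.2) h2))
    else Sum.inr ⟨hI (not_not.1 h0) (not_not.1 h1) (not_not.1 h2)⟩
  have r0 : ∀ {x : Corner α} (hx : x.1 ∈ G.edges) (h0 : x.1 ≠ e),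
      r ⟨x, hx⟩ = Sum.inl (H.cls S T x (hmem hx h0)) := fun hx h0 => dif_pos h0
  have r1 : ∀ {x : Corner α} (hx : x.1 ∈ G.edges) (h0 : x.1 = e) (h1 : (G.arc x).1 ≠ e),
      r ⟨x, hx⟩ = Sum.inl (H.cls S T (G.arc x) (hmem (G.arc_mem hx) h1)) := fun hx h0 h1 =>
    (dif_neg (not_not.2 h0)).trans (dif_pos h1)
  have r2 : ∀ {x : Corner α} (hx : x.1 ∈ G.edges) (h0 : x.1 = e) (h1 : (G.arc x).1 = e)
      (h2 : (G.arc x.alongSide).1 ≠ e),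
      r ⟨x, hx⟩ = Sum.inl (H.cls S T (G.arc x.alongSide)
        (hmem (G.arc_mem (x := x.alongSide) hx) h2)) := fun hx h0 h1 h2 =>
    (dif_neg (not_not.2 h0)).trans ((dif_neg (not_not.2 h1)).trans (dif_pos h2))
  have r3 : ∀ {x : Corner α} (hx : x.1 ∈ G.edges) (h0 : x.1 = e) (hi : I),
      r ⟨x, hx⟩ = Sum.inr ⟨hi⟩ := by
    rintro ⟨f, i, s⟩ hx h0 hi
    obtain rfl : f = e := h0
    have h1 : ¬ (G.arc (f, i, s)).1 ≠ f := by rw [hi i s]; simp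
    have h2 : ¬ (G.arc (Corner.alongSide (f, i, s))).1 ≠ f := by
      rw [Corner.alongSide, hi _ _]; simp
    exact (dif_neg (not_not.2 rfl)).trans ((dif_neg h1).trans (dif_neg h2))
  have hr : ∀ x y : G.Corners, G.link S T x y → r x = r y := by
    rintro ⟨x, hx⟩ ⟨y, hy⟩ (hh | ⟨hS, hh⟩ | ⟨hT, hh⟩)
    · -- an arc of `G`
      have main : ∀ x : Corner α, ∀ hx : x.1 ∈ G.edges, x.1 = e →
          r ⟨x, hx⟩ = r ⟨G.arc x, G.arc_mem hx⟩ := by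
        intro x hx hxe
        by_cases hye : (G.arc x).1 = e
        · by_cases h2 : (G.arc x.alongSide).1 = e
          · rw [r3 hx hxe (hI hxe hye h2), r3 (G.arc_mem hx) hye (hI hxe hye h2)]
          -- One end of `e` is alone on its vertex-disc. The arc of the contraction from `G.arc
          -- x.alongSide` then follows one free side of `e`, the arc from `x` to `G.arc x`, and the
          -- other free side.
          · have h3 : (G.arc (G.arc x).alongSide).1 ≠ e := by
              intro h3
              have hi := hI hye (by rw [G.arc_arc]; exact hxe) h3
              apply h2
              obtain ⟨f, i, s⟩ := x
              obtain rfl : f = e := hxe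
              rw [Corner.alongSide, hi _ _]; rfl
            rw [r2 hx hxe hye h2, r2 (G.arc_mem hx) hye (by rw [G.arc_arc]; exact hxe) h3]
            congr 1
            refine Quot.sound (Or.inl ?_)
            change G.arc (G.arc x).alongSide = H.arc (G.arc x.alongSide)
            rw [harc h2, G.arc_arc, G.passThrough_of_eq (y := x.alongSide) hxe,
              Corner.alongSide_alongSide, G.passThrough_of_eq hye]
        · rw [r1 hx hxe hye, r0 (G.arc_mem hx) hye]
      obtain rfl : y = G.arc x := hh
      by_cases hxe : x.1 = e
      · exact main x hx hxe
      · by_cases hye : (G.arc x).1 = e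
        · rw [main (G.arc x) hy hye]
          congr 2
          exact (G.arc_arc x).symm
        · rw [r0 hx hxe, r0 hy hye]
          congr 1
          refine Quot.sound (Or.inl ?_)
          change G.arc x = H.arc x
          rw [harc hxe, G.passThrough_of_ne hye, G.passThrough_of_ne hye]
    · have hxe : x.1 ≠ e := fun h => heS (h ▸ hS)
      obtain rfl : y = x.acrossEnd := hh
      rw [r0 hx hxe, r0 (x := x.acrossEnd) hy hxe]
      congr 1
      exact (H.cls_acrossEnd (hmem hx hxe) hS).symm
    · obtain rfl : y = x.alongSide := hh
      by_cases hxe : x.1 = e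
      · by_cases h1 : (G.arc x).1 = e
        · by_cases h2 : (G.arc x.alongSide).1 = e
          · rw [r3 hx hxe (hI hxe h1 h2), r3 (x := x.alongSide) hy hxe (hI hxe h1 h2)]
          · rw [r2 hx hxe h1 h2, r1 (x := x.alongSide) hy hxe h2]
        · by_cases h2 : (G.arc x.alongSide).1 = e
          · rw [r1 hx hxe h1, r2 (x := x.alongSide) hy hxe h2
              (by rw [Corner.alongSide_alongSide]; exact h1)]
            simp only [Corner.alongSide_alongSide]
          · rw [r1 hx hxe h1, r1 (x := x.alongSide) hy hxe h2]
            congr 1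
            refine Quot.sound (Or.inl ?_)
            change G.arc x.alongSide = H.arc (G.arc x)
            rw [harc h1, G.arc_arc, G.passThrough_of_eq hxe, G.passThrough_of_ne h2]
      · rw [r0 hx hxe, r0 (x := x.alongSide) hy hxe]
        congr 1
        exact (H.cls_alongSide (hmem hx hxe) hT).symm
  let k : H.Corners → Quot (G.link S T) := fun x =>
    G.cls S T x.1 (Finset.mem_of_mem_erase x.2)
  have hk : ∀ x y : H.Corners, H.link S T x y → k x = k y := by
    rintro ⟨x, hx⟩ ⟨y, hy⟩ (hh | ⟨hS, hh⟩ | ⟨hT, hh⟩)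
    · have hxe : x.1 ≠ e := Finset.ne_of_mem_erase hx
      have hx' : x.1 ∈ G.edges := Finset.mem_of_mem_erase hx
      obtain rfl : y = H.arc x := hh
      obtain ⟨m1, e1⟩ := G.cls_passThrough (S := S) heT (G.arc_mem hx')
      obtain ⟨m2, e2⟩ := G.cls_passThrough (S := S) heT m1
      change G.cls S T x _ = G.cls S T (H.arc x) _
      simp only [harc hxe]
      rw [e2, e1, G.cls_arc hx']
    · exact Quot.sound (Or.inr (Or.inl ⟨hS, hh⟩))
    · exact Quot.sound (Or.inr (Or.inr ⟨hT, hh⟩))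
  have eqv : Quot (G.link S T) ≃ Quot (H.link S T) ⊕ PLift I :=
    { toFun := Quot.lift r hr
      invFun := Sum.elim (Quot.lift k hk) (fun _ => G.cls S T (e, false, false) he)
      left_inv := by
        rintro ⟨x, hx⟩
        change Sum.elim (Quot.lift k hk) _ (r ⟨x, hx⟩) = G.cls S T x hx
        by_cases hxe : x.1 = e
        · by_cases h1 : (G.arc x).1 = e
          · by_cases h2 : (G.arc x.alongSide).1 = e
            · have hi := hI hxe h1 h2
              rw [r3 hx hxe hi]
              change G.cls S T (e, false, false) he = G.cls S T x hx
              obtain ⟨f, i, s⟩ := x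
              obtain rfl : f = e := hxe
              have a1 : ∀ i, G.cls S T (f, i, true) hx = G.cls S T (f, i, false) hx := by
                intro i
                have := G.cls_arc (S := S) (T := T) (x := (f, i, false)) hx
                simp only [hi i false] at this
                exact this
              have a2 : G.cls S T (f, true, false) hx = G.cls S T (f, false, false) hx :=
                G.cls_alongSide (x := (f, false, false)) hx heT
              cases i <;> cases s <;> simp only [a1, a2]
            · rw [r2 hx hxe h1 h2]
              exact (G.cls_arc (x := x.alongSide) hx).trans (G.cls_alongSide hx (hxe ▸ heT))
          · rw [r1 hx hxe h1]
            exact G.cls_arc hx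
        · rw [r0 hx hxe]; rfl
      right_inv := by
        rintro (⟨x, hx⟩ | hi)
        · exact r0 (Finset.mem_of_mem_erase hx) (Finset.ne_of_mem_erase hx)
        · exact r3 (x := (e, false, false)) he rfl hi.down }
  rw [numClasses, numClasses, Nat.card_congr eqv, Nat.card_sum]
  have : (G.contract e).isolated = Nat.card (PLift I) + G.isolated := by
    change G.isolated + (if I then 1 else 0) = _
    by_cases hi : I
    · have : Unique (PLift I) := ⟨⟨⟨hi⟩⟩, fun _ => rfl⟩
      rw [if_pos hi, Nat.card_unique, add_comm]
    · have : IsEmpty (PLift I) := ⟨fun h => hi h.down⟩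
      rw [if_neg hi, Nat.card_of_isEmpty, add_comm]
  rw [this, add_assoc]

end contract

/-! ### Partial Petrials, and their commutation with contraction -/

section petrial

variable [DecidableEq α]

theorem petrial_petrial (G : RibbonGraph α) {A B : Finset α} (h : Disjoint A B) :
    (G.petrial A).petrial B = G.petrial (A ∪ B) := by
  have : ∀ x, Corner.swapOn (A ∪ B) x = Corner.swapOn A (Corner.swapOn B x) := fun x => by
    rw [Finset.union_comm, Corner.swapOn_union h.symm]
  unfold petrial
  congr 1
  funext x
  rw [Corner.swapOn_union h, this]

/-- Half-twists do not change the classes of `link` when all the ends are used. -/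
theorem numClasses_petrial (G : RibbonGraph α) (A : Finset α) (T : Set α) :
    (G.petrial A).numClasses Set.univ T = G.numClasses Set.univ T := by
  -- The twist is an involution, so the same construction, applied from `G` to its Petrial and back,
  -- yields two mutually inverse maps.
  suffices key : ∀ G H : RibbonGraph α, G.edges = H.edges →
      (∀ x, H.arc x = Corner.swapOn A (G.arc (Corner.swapOn A x))) →
      ∃ f : Quot (H.link Set.univ T) → Quot (G.link Set.univ T),
        ∀ (x : Corner α) (hx : x.1 ∈ H.edges) (hx' : (Corner.swapOn A x).1 ∈ G.edges),
          f (H.cls _ _ x hx) = G.cls _ _ (Corner.swapOn A x) hx' by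
    obtain ⟨f, hf⟩ := key G (G.petrial A) rfl (fun x => rfl)
    obtain ⟨g, hg⟩ := key (G.petrial A) G rfl (fun x => by simp [petrial])
    have hs : ∀ {x : Corner α}, x.1 ∈ G.edges → (Corner.swapOn A x).1 ∈ G.edges := fun h => by
      rwa [Corner.swapOn_fst]
    rw [numClasses, numClasses]
    congr 1
    refine Nat.card_congr ⟨f, g, ?_, ?_⟩
    · rintro ⟨x, hx⟩
      change g (f ((G.petrial A).cls _ _ x hx)) = (G.petrial A).cls _ _ x hx
      rw [hf x hx (hs hx), hg _ (hs hx) (hs (hs hx))]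
      exact (G.petrial A).cls_congr hx (by simp)
    · rintro ⟨x, hx⟩
      change f (g (G.cls _ _ x hx)) = G.cls _ _ x hx
      rw [hg x hx (hs hx), hf _ (hs hx) (hs (hs hx))]
      exact G.cls_congr hx (by simp)
  intro G H hE harc
  have hs : ∀ {x : Corner α}, x.1 ∈ H.edges → (Corner.swapOn A x).1 ∈ G.edges := fun h => by
    rwa [Corner.swapOn_fst, hE]
  have hcls : ∀ (x : Corner α) (hx : x.1 ∈ G.edges) (hx' : (Corner.swapOn A x).1 ∈ G.edges),
      G.cls Set.univ T (Corner.swapOn A x) hx' = G.cls Set.univ T x hx := by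
    intro x hx hx'
    rcases Corner.swapOn_eq_or A x with h | h
    · exact G.cls_congr hx h
    · simp only [h]
      exact G.cls_acrossEnd hx (Set.mem_univ _)
  refine ⟨Quot.lift (fun x => G.cls Set.univ T (Corner.swapOn A x.1) (hs x.2)) ?_,
    fun x hx hx' => rfl⟩
  rintro ⟨x, hx⟩ ⟨y, hy⟩ (hh | ⟨_, hh⟩ | ⟨hT, hh⟩)
  · obtain rfl : y = H.arc x := hh
    simp only [harc, Corner.swapOn_swapOn]
    exact (G.cls_arc (hs hx)).symm
  · obtain rfl : y = x.acrossEnd := hh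
    simp only [Corner.swapOn_acrossEnd]
    exact (G.cls_acrossEnd (hs hx) (Set.mem_univ _)).symm
  · obtain rfl : y = x.alongSide := hh
    have hxG : x.1 ∈ G.edges := hE ▸ hx
    change G.cls Set.univ T (Corner.swapOn A x) _ = G.cls Set.univ T (Corner.swapOn A x.alongSide) _
    rw [hcls x hxG, hcls x.alongSide hxG]
    exact (G.cls_alongSide hxG hT).symm

/-- `swapOn A` fixes the corners of `e`, so it commutes with following a free side of `e` and merely
conjugates the arcs. -/
theorem passThrough_petrial (G : RibbonGraph α) {A : Finset α} {e : α} (he : e ∉ A)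
    (y : Corner α) : (G.petrial A).passThrough e (Corner.swapOn A y) =
      Corner.swapOn A (G.passThrough e y) := by
  by_cases hy : y.1 = e
  · have hyA : y.1 ∉ A := hy ▸ he
    rw [passThrough_of_eq _ ((Corner.swapOn_fst A y).trans hy), passThrough_of_eq _ hy,
      Corner.swapOn_of_notMem hyA]
    change Corner.swapOn A (G.arc (Corner.swapOn A y.alongSide)) = _
    rw [Corner.swapOn_of_notMem (x := y.alongSide) hyA]
  · rw [passThrough_of_ne _ hy, passThrough_of_ne]
    rwa [Corner.swapOn_fst]

/-- Twisting and contracting distinct edges commute. -/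
theorem contract_petrial (G : RibbonGraph α) {A : Finset α} {e : α} (he : e ∉ A) :
    (G.petrial A).contract e = (G.contract e).petrial A := by
  have h1 : (G.petrial A).contractArc e =
      fun x => Corner.swapOn A (G.contractArc e (Corner.swapOn A x)) := by
    funext x
    unfold contractArc
    by_cases hx : x.1 = e
    · simp [hx]
    · rw [if_neg hx, if_neg (by rwa [Corner.swapOn_fst])]
      change (G.petrial A).passThrough e ((G.petrial A).passThrough e
        (Corner.swapOn A (G.arc (Corner.swapOn A x)))) = _
      rw [G.passThrough_petrial he, G.passThrough_petrial he]
  have h2 : (∀ i s : Bool, (G.petrial A).arc (e, i, s) = Corner.acrossEnd (e, i, s)) ↔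
      (∀ i s : Bool, G.arc (e, i, s) = Corner.acrossEnd (e, i, s)) := by
    refine forall_congr' fun i => forall_congr' fun s => ?_
    change Corner.swapOn A (G.arc (Corner.swapOn A (e, i, s))) = _ ↔ _
    rw [Corner.swapOn_of_notMem (x := (e, i, s)) he]
    constructor
    · intro h
      rw [← Corner.swapOn_swapOn A (G.arc _), h]
      exact Corner.swapOn_of_notMem he
    · intro h
      rw [h]
      exact Corner.swapOn_of_notMem he
  unfold contract
  rw [petrial.eq_def]
  congr 1
  exact congrArg (G.isolated + ·) (if_congr h2 rfl rfl)

theorem aux_petrial (G : RibbonGraph α) {A : Finset α} (l : List α) (hl : ∀ e ∈ l, e ∉ A) :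
    (G.petrial A).aux l = (G.aux l).petrial A := by
  induction l generalizing G with
  | nil => rfl
  | cons e l ih =>
    change ((G.petrial A).contract e).aux l = ((G.contract e).aux l).petrial A
    rw [G.contract_petrial (hl e (by simp)), ih _ fun f hf => hl f (by simp [hf])]

theorem edges_aux (G : RibbonGraph α) (l : List α) : (G.aux l).edges = G.edges \ l.toFinset := by
  induction l generalizing G with
  | nil => simp [aux]
  | cons e l ih =>
    change ((G.contract e).aux l).edges = _
    rw [ih]
    ext x
    simp [contract]
    tauto

end petrial

/-! ### Spanning trees and their contraction -/

/-- `T` links all the vertices together and has as few edges as this allows. -/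
structure Spans (G : RibbonGraph α) (T : Finset α) : Prop where
  subset : T ⊆ G.edges
  numClasses_eq_one : G.numClasses Set.univ T = 1
  numVertices_eq : G.numVertices = T.card + 1

section spans

variable [DecidableEq α]

theorem Spans.petrial {G : RibbonGraph α} {T : Finset α} (h : G.Spans T) (A : Finset α) :
    (G.petrial A).Spans T where
  subset := h.subset
  numClasses_eq_one := (G.numClasses_petrial A T).trans h.numClasses_eq_one
  numVertices_eq := by
    rw [RibbonGraph.numVertices_eq, numClasses_petrial, ← RibbonGraph.numVertices_eq,
      h.numVertices_eq]

/-- If `e` were a loop, the `|T| - 1` other edges would already link all `|T| + 1` vertices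
together, but each edge lowers the number of classes by at most one. -/
theorem Spans.nonloop {G : RibbonGraph α} {T : Finset α} (h : G.Spans T) {e : α} (he : e ∈ T) :
    G.Nonloop e := by
  refine ⟨h.subset he, fun hloop => ?_⟩
  have h1 := G.numClasses_insert_of_cls_eq (T := (T.erase e : Finset α)) (h.subset he)
    (G.cls_mono (le_refl _) (Set.empty_subset _) hloop)
  have h2 := G.numClasses_le_add_card (T.erase e) ((Finset.erase_subset _ _).trans h.subset)
  rw [← Finset.coe_insert, Finset.insert_erase he, h.numClasses_eq_one] at h1
  rw [← RibbonGraph.numVertices_eq, h.numVertices_eq] at h2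
  have := Finset.card_erase_add_one he
  omega

/-- The ends of `e` are first dropped from the links, as `Nonloop.numClasses_contract` demands;
afterwards `{e}ᶜ` and `univ` agree on the edges of the contraction. -/
theorem Nonloop.numClasses_contract_univ {G : RibbonGraph α} {e : α} (h : G.Nonloop e)
    {T : Set α} (he : e ∈ T) :
    (G.contract e).numClasses Set.univ T = G.numClasses Set.univ T := by
  rw [h.numClasses_compl, h.numClasses_contract (by simp) he]
  refine numClasses_congr _ (fun f hf => ?_) fun _ _ => Iff.rfl
  simp [Finset.ne_of_mem_erase hf]

/-- The vertices of the contraction are the classes of `G` when the free sides of `e` alone are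
added to the vertex links, which merges the two vertices of `e`. -/
theorem Nonloop.numVertices_contract {G : RibbonGraph α} {e : α} (h : G.Nonloop e) :
    (G.contract e).numVertices + 1 = G.numVertices := by
  obtain ⟨he, h'⟩ := id h
  have h1 := G.numClasses_insert_add_one he h'
  rw [← h.numClasses_contract_univ (by simp)] at h1
  rw [RibbonGraph.numVertices_eq, RibbonGraph.numVertices_eq, ← h1]
  congr 1
  refine numClasses_congr _ (fun _ _ => Iff.rfl) fun f hf => ?_
  simp [Finset.ne_of_mem_erase hf]

/-- `|V|` and `|E|` both drop by one and cancel in the Euler characteristic, while `|F|` and `c` are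
unchanged. -/
theorem Nonloop.eulerGenus_contract {G : RibbonGraph α} {e : α} (h : G.Nonloop e) :
    (G.contract e).eulerGenus = G.eulerGenus := by
  have h1 := h.numVertices_contract
  have h2 := h.numClasses_contract_univ (Set.mem_univ e)
  have h3 := h.numClasses_contract (Set.notMem_empty e) (Set.mem_univ e)
  have h4 : (G.contract e).edges.card + 1 = G.edges.card := Finset.card_erase_add_one h.1
  rw [← numComponents_eq, ← numComponents_eq] at h2
  rw [← numFaces_eq, ← numFaces_eq] at h3
  rw [eulerGenus, eulerGenus, eulerChar, eulerChar]
  omega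

theorem Spans.contract {G : RibbonGraph α} {T : Finset α} (h : G.Spans T) {e : α} (he : e ∈ T) :
    (G.contract e).Spans (T.erase e) where
  subset := Finset.erase_subset_erase e h.subset
  numClasses_eq_one := by
    rw [← h.numClasses_eq_one, ← (h.nonloop he).numClasses_contract_univ (Finset.mem_coe.2 he)]
    refine numClasses_congr _ (fun _ _ => Iff.rfl) fun f hf => ?_
    simp [Finset.ne_of_mem_erase hf]
  numVertices_eq := by
    have h1 := (h.nonloop he).numVertices_contract
    have h2 := h.numVertices_eq
    have h3 := Finset.card_erase_add_one he
    omega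

theorem Spans.aux {G : RibbonGraph α} {l : List α} (hl : l.Nodup) (h : G.Spans l.toFinset) :
    (G.aux l).IsBouquet ∧ (G.aux l).eulerGenus = G.eulerGenus := by
  induction l generalizing G with
  | nil => exact ⟨h.numVertices_eq, rfl⟩
  | cons e l ih =>
    have he : e ∈ (e :: l).toFinset := by simp
    have hl' := List.nodup_cons.1 hl
    have h1 : (e :: l).toFinset.erase e = l.toFinset := by
      rw [List.toFinset_cons, Finset.erase_insert (by simpa using hl'.1)]
    obtain ⟨h2, h3⟩ := ih hl'.2 (h1 ▸ h.contract he)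
    exact ⟨h2, h3.trans (h.nonloop he).eulerGenus_contract⟩

end spans

instance (G : RibbonGraph α) : Finite G.Vertex :=
  inferInstanceAs (Finite (Quot _ ⊕ Fin G.isolated))

theorem IsSpanningTree.numVertices_eq {G : RibbonGraph α} {T : Finset α}
    (hT : G.IsSpanningTree T) : G.numVertices = T.card + 1 := by
  classical
  have := Fintype.ofFinite G.Vertex
  have h1 := hT.isTree.card_edgeFinset
  rw [numVertices, Nat.card_eq_fintype_card, ← h1]
  congr 1
  symm
  refine Finset.card_bij (fun e he => G.ends ⟨e, hT.subset he⟩) ?_ ?_ ?_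
  · intro e he
    rw [SimpleGraph.mem_edgeFinset, SimpleGraph.edgeSet_fromEdgeSet]
    exact ⟨⟨_, he, rfl⟩, hT.not_loop _ he⟩
  · intro e he f hf h
    exact congrArg Subtype.val (hT.not_parallel _ _ he hf h)
  · intro p hp
    rw [SimpleGraph.mem_edgeFinset, SimpleGraph.edgeSet_fromEdgeSet] at hp
    obtain ⟨⟨e, he, rfl⟩, -⟩ := hp
    exact ⟨e.1, he, rfl⟩

/-- The map from vertices to classes is onto and constant along tree edges, hence constant because
the tree is connected. -/
theorem IsSpanningTree.spans {G : RibbonGraph α} {T : Finset α} (hT : G.IsSpanningTree T) :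
    G.Spans T where
  subset := hT.subset
  numVertices_eq := hT.numVertices_eq
  numClasses_eq_one := by
    let p : G.Vertex → Quot (G.link Set.univ T) ⊕ Fin G.isolated :=
      Sum.map (Quot.lift (fun x => G.cls Set.univ T x.1 x.2) (by
        rintro x y (h | h)
        · exact Quot.sound (Or.inl h)
        · exact Quot.sound (Or.inr (Or.inl ⟨trivial, h⟩)))) id
    have hp : Function.Surjective p := by
      rintro (⟨⟨x⟩⟩ | i)
      · exact ⟨Sum.inl (Quot.mk _ x), rfl⟩
      · exact ⟨Sum.inr i, rfl⟩
    have hadj : ∀ u v, (SimpleGraph.fromEdgeSet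
        {p | ∃ e : G.edges, e.1 ∈ T ∧ G.ends e = p}).Adj u v → p u = p v := by
      intro u v huv
      obtain ⟨⟨e, he, huv⟩, -⟩ := (SimpleGraph.fromEdgeSet_adj _).1 huv
      have h1 : p (G.endVertex e false) = p (G.endVertex e true) := congrArg Sum.inl
        (G.cls_alongSide (S := Set.univ) (T := T) (x := (e.1, false, false)) e.2 he).symm
      rcases Sym2.eq_iff.1 huv with ⟨rfl, rfl⟩ | ⟨rfl, rfl⟩
      · exact h1
      · exact h1.symm
    have hconst : ∀ u v, p u = p v := by
      intro u v
      obtain ⟨w⟩ := hT.isTree.connected.preconnected u v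
      induction w with
      | nil => rfl
      | cons h _ ih => exact (hadj _ _ h).trans ih
    have hne : Nonempty G.Vertex := hT.isTree.connected.nonempty
    have h2 : Nat.card (Quot (G.link Set.univ T) ⊕ Fin G.isolated) = 1 := by
      rw [Nat.card_eq_one_iff_unique]
      refine ⟨⟨fun a b => ?_⟩, hne.map p⟩
      obtain ⟨u, rfl⟩ := hp a
      obtain ⟨v, rfl⟩ := hp b
      exact hconst u v
    rwa [Nat.card_sum, Nat.card_fin] at h2

/-! ### The walk around a vertex-disc -/

section next

variable (G : RibbonGraph α)

theorem next_injective : Function.Injective G.next := by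
  intro x y h
  have := congrArg G.arc h
  simp only [next, G.arc_arc] at this
  rw [← x.acrossEnd_acrossEnd, this, y.acrossEnd_acrossEnd]

theorem next_mem {x : Corner α} (hx : x.1 ∈ G.edges) : (G.next x).1 ∈ G.edges :=
  G.arc_mem (x := x.acrossEnd) hx

theorem iterate_next_mem {x : Corner α} (hx : x.1 ∈ G.edges) (k : ℕ) :
    (G.next^[k] x).1 ∈ G.edges := by
  induction k with
  | zero => exact hx
  | succ k ih => rw [Function.iterate_succ_apply']; exact G.next_mem ih

theorem arc_iterate_succ (x : Corner α) (k : ℕ) :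
    G.arc (G.next^[k + 1] x) = (G.next^[k] x).acrossEnd := by
  rw [Function.iterate_succ_apply', next, G.arc_arc]

theorem arc_acrossEnd_iterate (x : Corner α) (k : ℕ) :
    G.arc (G.next^[k] x).acrossEnd = G.next^[k + 1] x := by
  rw [Function.iterate_succ_apply', next]

/-- Crossing the current end reverses the direction of the walk, so `m` more steps retrace the first
`m`. -/
theorem iterate_next_acrossEnd_iterate (x : Corner α) (m : ℕ) :
    G.next^[m] (G.next^[m] x).acrossEnd = x.acrossEnd := by
  induction m with
  | zero => rfl
  | succ m ih =>
    have h : G.next (G.next^[m + 1] x).acrossEnd = (G.next^[m] x).acrossEnd := by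
      rw [next, Corner.acrossEnd_acrossEnd, arc_iterate_succ]
    rw [Function.iterate_succ_apply, h, ih]

/-- The walk around a vertex crosses every end in only one direction. -/
theorem iterate_next_ne_acrossEnd {x : Corner α} (hx : x.1 ∈ G.edges) (k : ℕ) :
    G.next^[k] x ≠ x.acrossEnd := by
  intro h
  -- A walk reaching `x.acrossEnd` would turn around halfway: at an end whose two corners coincide
  -- if `k` is even, at an arc with a single extremity if `k` is odd. Neither exists.
  rcases Nat.even_or_odd' k with ⟨m, rfl | rfl⟩
  · rw [two_mul, Function.iterate_add_apply, ← G.iterate_next_acrossEnd_iterate x m] at h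
    exact Corner.acrossEnd_ne _ (G.next_injective.iterate m h).symm
  · rw [two_mul, add_assoc, Function.iterate_add_apply,
      ← G.iterate_next_acrossEnd_iterate x m] at h
    have h' := G.next_injective.iterate m h
    rw [Function.iterate_succ_apply'] at h'
    exact G.arc_ne (x := (G.next^[m] x).acrossEnd) (G.iterate_next_mem hx m) h'

theorem iterate_next_ne_acrossEnd_iterate {x : Corner α} (hx : x.1 ∈ G.edges) (s t : ℕ) :
    G.next^[t] x ≠ (G.next^[s] x).acrossEnd := by
  intro h
  rcases le_total s t with hst | hst
  · obtain ⟨k, rfl⟩ := Nat.exists_eq_add_of_le' hst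
    rw [Function.iterate_add_apply] at h
    exact G.iterate_next_ne_acrossEnd (G.iterate_next_mem hx s) k h
  · obtain ⟨k, rfl⟩ := Nat.exists_eq_add_of_le' hst
    rw [Function.iterate_add_apply] at h
    apply G.iterate_next_ne_acrossEnd (G.iterate_next_mem hx t) k
    have h' := congrArg Corner.acrossEnd h
    rw [Corner.acrossEnd_acrossEnd] at h'
    exact h'.symm

/-- `Corner α` may be infinite; finiteness comes from `G.Corners`, to which `next` restricts as an
injection. -/
theorem mem_periodicPts_next {x : Corner α} (hx : x.1 ∈ G.edges) :
    x ∈ Function.periodicPts G.next := by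
  let f : G.Corners → G.Corners := fun y => ⟨G.next y.1, G.next_mem y.2⟩
  have hf : Function.Injective f := fun y z h =>
    Subtype.ext (G.next_injective (congrArg Subtype.val h))
  obtain ⟨n, hn, h⟩ := hf.mem_periodicPts ⟨x, hx⟩
  refine ⟨n, hn, ?_⟩
  have hs : Function.Semiconj Subtype.val f G.next := fun y => rfl
  exact h.map hs

/-- The walk around a vertex visits every end at most once in a period. -/
theorem iterate_next_inj {x : Corner α} (hx : x.1 ∈ G.edges) {s t : ℕ}
    (hs : s < Function.minimalPeriod G.next x) (ht : t < Function.minimalPeriod G.next x)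
    (h1 : (G.next^[s] x).1 = (G.next^[t] x).1) (h2 : (G.next^[s] x).2.1 = (G.next^[t] x).2.1) :
    s = t := by
  by_cases h3 : (G.next^[s] x).2.2 = (G.next^[t] x).2.2
  · exact (Function.iterate_injOn_Iio_minimalPeriod (f := G.next) (x := x)) hs ht
      (Prod.ext h1 (Prod.ext h2 h3))
  · exfalso
    apply G.iterate_next_ne_acrossEnd_iterate hx t s
    refine Prod.ext h1 (Prod.ext h2 ?_)
    change _ = !_
    revert h3
    cases (G.next^[s] x).2.2 <;> cases (G.next^[t] x).2.2 <;> simp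

/-- An edge has only two ends and each is met at most once in a period, so two visits that both
differ from a third must coincide. -/
theorem iterate_next_two {x : Corner α} (hx : x.1 ∈ G.edges) {s t u : ℕ}
    (hs : s < Function.minimalPeriod G.next x) (ht : t < Function.minimalPeriod G.next x)
    (hu : u < Function.minimalPeriod G.next x)
    (h1 : (G.next^[s] x).1 = (G.next^[t] x).1) (h2 : (G.next^[u] x).1 = (G.next^[t] x).1)
    (hst : s ≠ t) (hut : u ≠ t) : s = u := by
  refine G.iterate_next_inj hx hs hu (h1.trans h2.symm) ?_
  have h3 := fun h => hst (G.iterate_next_inj hx hs ht h1 h)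
  have h4 := fun h => hut (G.iterate_next_inj hx hu ht h2 h)
  revert h3 h4
  cases (G.next^[s] x).2.1 <;> cases (G.next^[t] x).2.1 <;> cases (G.next^[u] x).2.1 <;> simp

theorem Interlaced.symm {G : RibbonGraph α} {a b : α} (h : G.Interlaced a b) :
    G.Interlaced b a := by
  obtain ⟨x, i, j, k, hi, hij, hjk, hk, ha, hb, ha', hb'⟩ := h
  -- `minimalPeriod` is `0` at points that are not periodic, so `hk` already makes `x` periodic. The
  -- walk is restarted at its `i`-th corner.
  have hp : 0 < Function.minimalPeriod G.next x := by omega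
  have hper := Function.minimalPeriod_pos_iff_mem_periodicPts.1 hp
  refine ⟨G.next^[i] x, j - i, k - i, Function.minimalPeriod G.next x - i,
    by omega, by omega, by omega, ?_, hb, ?_, ?_, ?_⟩
  · rw [Function.minimalPeriod_apply_iterate hper]; omega
  all_goals rw [← Function.iterate_add_apply, Nat.sub_add_cancel (by omega)]
  · exact ha'
  · exact hb'
  · rw [Function.iterate_minimalPeriod]; exact ha

end next

/-! ### Bouquets: potentials and interlacement -/

section bouquet

variable {B : RibbonGraph α}

theorem IsBouquet.isolated_eq_zero (hB : B.IsBouquet) (hne : B.edges.Nonempty) :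
    B.isolated = 0 ∧ Subsingleton (Quot (B.link Set.univ ∅)) := by
  obtain ⟨e, he⟩ := hne
  have h : B.numVertices = 1 := hB
  rw [numVertices_eq, numClasses] at h
  have : Nonempty (Quot (B.link Set.univ ∅)) := ⟨B.cls _ _ (e, false, false) he⟩
  have hpos : 0 < Nat.card (Quot (B.link Set.univ ∅)) := Nat.card_pos
  refine ⟨by omega, ?_⟩
  have h1 : Nat.card (Quot (B.link Set.univ ∅)) = 1 := by omega
  exact (Nat.card_eq_one_iff_unique.1 h1).1

/-- In a bouquet, what is preserved by arcs and ends is the same everywhere. -/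
theorem IsBouquet.eq_of_invariant (hB : B.IsBouquet) {β : Type*} {g : Corner α → β}
    (h1 : ∀ x, x.1 ∈ B.edges → g (B.arc x) = g x)
    (h2 : ∀ x, x.1 ∈ B.edges → g x.acrossEnd = g x) {x y : Corner α} (hx : x.1 ∈ B.edges)
    (hy : y.1 ∈ B.edges) : g x = g y := by
  have := (hB.isolated_eq_zero ⟨_, hx⟩).2
  let f : Quot (B.link Set.univ ∅) → β := Quot.lift (fun x => g x.1) (by
    rintro ⟨x, hx⟩ ⟨y, hy⟩ (hh | ⟨_, hh⟩ | ⟨hh, _⟩)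
    · obtain rfl : y = B.arc x := hh
      exact (h1 x hx).symm
    · obtain rfl : y = x.acrossEnd := hh
      exact (h2 x hx).symm
    · exact hh.elim)
  exact congrArg f (Subsingleton.elim (B.cls _ _ x hx) (B.cls _ _ y hy))

/-- The corners of the walk and their partners across the ends form a set closed under arcs and
ends, which in a bouquet is everything. -/
theorem IsBouquet.exists_iterate_next (hB : B.IsBouquet) {x y : Corner α} (hx : x.1 ∈ B.edges)
    (hy : y.1 ∈ B.edges) : ∃ k < Function.minimalPeriod B.next x,
      y = B.next^[k] x ∨ y = (B.next^[k] x).acrossEnd := by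
  have hpos := Function.minimalPeriod_pos_of_mem_periodicPts (B.mem_periodicPts_next hx)
  suffices h : ∃ k, y = B.next^[k] x ∨ y = (B.next^[k] x).acrossEnd by
    obtain ⟨k, hk⟩ := h
    refine ⟨k % Function.minimalPeriod B.next x, Nat.mod_lt _ hpos, ?_⟩
    rwa [Function.iterate_mod_minimalPeriod_eq]
  let P : Corner α → Prop := fun y => ∃ k, y = B.next^[k] x ∨ y = (B.next^[k] x).acrossEnd
  have h1 : ∀ y, P y → P (B.arc y) := by
    rintro y ⟨k, rfl | rfl⟩
    · cases k with
      | zero =>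
        -- The corner preceding `x` in the walk is the last one of its period.
        refine ⟨Function.minimalPeriod B.next x - 1, Or.inr ?_⟩
        rw [← arc_iterate_succ, Nat.sub_add_cancel hpos, Function.iterate_minimalPeriod]
        rfl
      | succ k => exact ⟨k, Or.inr (B.arc_iterate_succ x k)⟩
    · exact ⟨k + 1, Or.inl (B.arc_acrossEnd_iterate x k)⟩
  have h2 : ∀ y, P y → P y.acrossEnd := by
    rintro y ⟨k, rfl | rfl⟩
    · exact ⟨k, Or.inr rfl⟩
    · exact ⟨k, Or.inl (Corner.acrossEnd_acrossEnd _)⟩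
  have h3 : P x = P y := hB.eq_of_invariant
    (fun y _ => propext ⟨fun h => B.arc_arc y ▸ h1 _ h, h1 y⟩)
    (fun y _ => propext ⟨fun h => y.acrossEnd_acrossEnd ▸ h2 _ h, h2 y⟩) hx hy
  exact h3.mp ⟨0, Or.inl rfl⟩

theorem IsBouquet.exists_other_end (hB : B.IsBouquet) {b : α} (hb : b ∈ B.edges) :
    ∃ q < Function.minimalPeriod B.next (b, false, false), 0 < q ∧
      (B.next^[q] (b, false, false)).1 = b ∧ (B.next^[q] (b, false, false)).2.1 = true := by
  obtain ⟨q, hq, h⟩ := hB.exists_iterate_next (x := (b, false, false)) (y := (b, true, false)) hb hb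
  have h' : (B.next^[q] (b, false, false)).1 = b ∧
      (B.next^[q] (b, false, false)).2.1 = true := by
    rcases h with h | h
    · rw [← h]; simp
    · rw [← Corner.acrossEnd_acrossEnd (B.next^[q] (b, false, false)), ← h]
      simp [Corner.acrossEnd]
  refine ⟨q, hq, Nat.pos_of_ne_zero ?_, h'⟩
  rintro rfl
  exact absurd h'.2 (by simp)

/-- A potential of the edge `b`: a `GF(2)`-valued function on the boundary of the vertex-discs that
is constant on arcs and jumps exactly at the ends of `b`. -/
structure IsPotential (B : RibbonGraph α) (b : α) (φ : Corner α → ZMod 2) : Prop where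
  arc : ∀ x, φ (B.arc x) = φ x
  jump : ∀ x, x.1 = b → φ x.acrossEnd = φ x + 1
  acrossEnd : ∀ x, x.1 ∈ B.edges → x.1 ≠ b → φ x.acrossEnd = φ x

theorem IsBouquet.exists_isPotential (hB : B.IsBouquet) {b : α} (hb : b ∈ B.edges) :
    ∃ φ, B.IsPotential b φ := by
  classical
  obtain ⟨q, hq, hq0, hqb, hqt⟩ := hB.exists_other_end hb
  have hpos : 0 < Function.minimalPeriod B.next (b, false, false) := by omega
  obtain ⟨x, hx⟩ : ∃ x : Corner α, x = (b, false, false) := ⟨_, rfl⟩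
  rw [← hx] at hq hqb hqt hpos
  have hxm : x.1 ∈ B.edges := by rw [hx]; exact hb
  have hxb : x.1 = b := by rw [hx]
  -- The potential is the indicator of the stretch of the circle that starts just after the end of
  -- `b` at `x` and stops on reaching its other end at step `q`. Arcs never leave it, and only the
  -- two ends of `b` cross its border.
  let P : Corner α → Prop := fun y =>
    ∃ k < q, y = (B.next^[k] x).acrossEnd ∨ y = B.next^[k + 1] x
  have hinj : ∀ {s t}, s < Function.minimalPeriod B.next x →
      t < Function.minimalPeriod B.next x → B.next^[s] x = B.next^[t] x → s = t :=
    fun hs ht h => Function.iterate_injOn_Iio_minimalPeriod (f := B.next) hs ht h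
  have hP1 : ∀ t < Function.minimalPeriod B.next x, P (B.next^[t] x) ↔ 0 < t ∧ t ≤ q := by
    intro t ht
    constructor
    · rintro ⟨k, hk, h | h⟩
      · exact absurd h (B.iterate_next_ne_acrossEnd_iterate hxm _ _)
      · have := hinj ht (by omega) h
        omega
    · rintro ⟨h0, h1⟩
      exact ⟨t - 1, by omega, Or.inr (by rw [Nat.sub_add_cancel h0])⟩
  have hP2 : ∀ t < Function.minimalPeriod B.next x, P (B.next^[t] x).acrossEnd ↔ t < q := by
    intro t ht
    constructor
    · rintro ⟨k, hk, h | h⟩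
      · have h' := congrArg Corner.acrossEnd h
        rw [Corner.acrossEnd_acrossEnd, Corner.acrossEnd_acrossEnd] at h'
        have := hinj ht (by omega) h'
        omega
      · exact absurd h.symm (B.iterate_next_ne_acrossEnd_iterate hxm _ _)
    · exact fun h => ⟨t, h, Or.inl rfl⟩
  have hb2 : ∀ t < Function.minimalPeriod B.next x, (B.next^[t] x).1 = b ↔ t = 0 ∨ t = q := by
    intro t ht
    constructor
    · intro h
      by_contra hne
      push Not at hne
      have := B.iterate_next_two hxm ht hpos hq (h.trans hxb.symm)
        (hqb.trans hxb.symm) hne.1 hq0.ne'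
      exact hne.2 this
    · rintro (rfl | rfl)
      · exact hxb
      · exact hqb
  have harc : ∀ y, P y → P (B.arc y) := by
    rintro y ⟨k, hk, rfl | rfl⟩
    · exact ⟨k, hk, Or.inr (B.arc_acrossEnd_iterate x k)⟩
    · exact ⟨k, hk, Or.inl (B.arc_iterate_succ x k)⟩
  have hcross : ∀ y, y.1 ∈ B.edges → ((P y.acrossEnd ↔ P y) ↔ y.1 ≠ b) := by
    intro y hy
    obtain ⟨t, ht, rfl | rfl⟩ := hB.exists_iterate_next hxm hy
    · rw [hP1 t ht, hP2 t ht, Ne, hb2 t ht]; omega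
    · rw [Corner.acrossEnd_acrossEnd, hP1 t ht, hP2 t ht, Ne, Corner.acrossEnd_fst, hb2 t ht]
      omega
  refine ⟨fun y => if P y then 1 else 0, ?_, ?_, ?_⟩
  · intro y
    have : P (B.arc y) ↔ P y := ⟨fun h => B.arc_arc y ▸ harc _ h, harc y⟩
    simp only [this]
  · intro y hyb
    have := hcross y (hyb ▸ hb)
    by_cases h1 : P y <;> by_cases h2 : P y.acrossEnd <;> simp_all
    decide
  · intro y hy hyb
    have := (hcross y hy).2 hyb
    simp only [this]

section potential

variable {b : α} {φ : Corner α → ZMod 2}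

/-- Along the walk, a potential counts modulo 2 the ends of `b` that have been crossed. -/
theorem IsPotential.apply_iterate_next [DecidableEq α] (hφ : B.IsPotential b φ) {x : Corner α}
    (hx : x.1 ∈ B.edges) (j : ℕ) :
    φ (B.next^[j] x) = φ x + ∑ t ∈ Finset.range j, if (B.next^[t] x).1 = b then 1 else 0 := by
  induction j with
  | zero => simp
  | succ j ih =>
    rw [Finset.sum_range_succ, ← add_assoc, ← ih, Function.iterate_succ_apply', next, hφ.arc]
    split_ifs with h
    · exact hφ.jump _ h
    · rw [hφ.acrossEnd _ (B.iterate_next_mem hx j) h, add_zero]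

theorem IsPotential.apply_end (hφ : B.IsPotential b φ) {x : Corner α} (hx : x.1 ∈ B.edges)
    (hab : x.1 ≠ b) : φ x = φ (x.1, x.2.1, false) := by
  obtain ⟨e, i, s⟩ := x
  cases s
  · rfl
  · exact hφ.acrossEnd (e, i, false) hx hab

/-- The ends of `a` cut the circle into two stretches; `φ` differs at these ends iff each stretch
contains an odd number of ends of `b`, that is exactly one. -/
theorem IsPotential.interlaced_iff (hB : B.IsBouquet) (hφ : B.IsPotential b φ) {a : α}
    (ha : a ∈ B.edges) (hab : a ≠ b) :
    B.Interlaced a b ↔ φ (a, false, false) ≠ φ (a, true, false) := by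
  classical
  constructor
  · rintro ⟨x, i, j, k, hi, hij, hjk, hk, hxa, hxi, hxj, hxk⟩
    have hx : x.1 ∈ B.edges := hxa ▸ ha
    have h1 := hφ.apply_iterate_next hx j
    -- Before `j` the edge `b` is met only at step `i`, since its other end is met at step `k > j`.
    rw [Finset.sum_eq_single i, if_pos hxi] at h1
    · rw [hφ.apply_end (B.iterate_next_mem hx j) (by rw [hxj]; exact hab),
        hφ.apply_end hx (by rw [hxa]; exact hab), hxj, hxa] at h1
      have h2 : (B.next^[j] x).2.1 ≠ x.2.1 := by
        intro h
        have := B.iterate_next_inj hx (s := j) (t := 0) (by omega) (by omega)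
          (hxj.trans hxa.symm) h
        omega
      have h3 : ∀ u : ZMod 2, u ≠ u + 1 := by decide
      revert h1 h2
      cases (B.next^[j] x).2.1 <;> cases x.2.1 <;> intro h1 h2
      · exact absurd rfl h2
      · rw [h1]; exact (h3 _).symm
      · rw [h1]; exact h3 _
      · exact absurd rfl h2
    · intro t ht hti
      rw [if_neg]
      intro htb
      have ht := Finset.mem_range.1 ht
      have := B.iterate_next_two hx (s := t) (t := i) (u := k) (by omega) (by omega) hk
        (htb.trans hxi.symm) (hxk.trans hxi.symm) hti (by omega)
      omega
    · intro h
      exact absurd (Finset.mem_range.2 hij) h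
  · intro h
    obtain ⟨j, hj, hj0, hja, hjt⟩ := hB.exists_other_end ha
    obtain ⟨x, hx⟩ : ∃ x : Corner α, x = (a, false, false) := ⟨_, rfl⟩
    rw [← hx] at hj hja hjt h
    have hxa : x.1 = a := by rw [hx]
    have hxm : x.1 ∈ B.edges := hxa ▸ ha
    have h1 := hφ.apply_iterate_next hxm j
    -- After a full period `φ` returns to its value at `x`, so the stretch from `j` onwards also
    -- changes `φ` and contains an end of `b`.
    have h2 := hφ.apply_iterate_next hxm (Function.minimalPeriod B.next x)
    rw [hφ.apply_end (B.iterate_next_mem hxm j) (by rw [hja]; exact hab), hja, hjt] at h1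
    rw [Function.iterate_minimalPeriod, ← Finset.sum_range_add_sum_Ico _ hj.le, ← add_assoc,
      ← h1] at h2
    have h3 : ∑ t ∈ Finset.range j, (if (B.next^[t] x).1 = b then 1 else 0 : ZMod 2) ≠ 0 := by
      intro h0
      rw [h0, add_zero] at h1
      exact h h1.symm
    have h4 : ∑ t ∈ Finset.Ico j (Function.minimalPeriod B.next x),
        (if (B.next^[t] x).1 = b then 1 else 0 : ZMod 2) ≠ 0 := by
      intro h0
      rw [h0, add_zero] at h2
      exact h h2
    obtain ⟨i, hi, hib⟩ := Finset.exists_ne_zero_of_sum_ne_zero h3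
    obtain ⟨k, hk, hkb⟩ := Finset.exists_ne_zero_of_sum_ne_zero h4
    have hib : (B.next^[i] x).1 = b := by
      by_contra h; exact hib (if_neg h)
    have hkb : (B.next^[k] x).1 = b := by
      by_contra h; exact hkb (if_neg h)
    rw [Finset.mem_range] at hi
    rw [Finset.mem_Ico] at hk
    refine ⟨x, i, j, k, Nat.pos_of_ne_zero ?_, hi, lt_of_le_of_ne hk.1 ?_, hk.2, hxa, hib, hja, hkb⟩
    · rintro rfl
      exact hab (hxa.symm.trans hib)
    · rintro rfl
      exact hab (hja.symm.trans hkb)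

theorem IsPotential.petrial [DecidableEq α] (hφ : B.IsPotential b φ) (Y : Finset α) :
    (B.petrial Y).IsPotential b (fun x => φ (Corner.swapOn Y x)) where
  arc x := by
    change φ (Corner.swapOn Y (Corner.swapOn Y (B.arc (Corner.swapOn Y x)))) = _
    rw [Corner.swapOn_swapOn, hφ.arc]
  jump x hx := by
    rw [Corner.swapOn_acrossEnd]
    exact hφ.jump _ (by rwa [Corner.swapOn_fst])
  acrossEnd x hx hxb := by
    rw [Corner.swapOn_acrossEnd]
    exact hφ.acrossEnd _ (by rwa [Corner.swapOn_fst]) (by rwa [Corner.swapOn_fst])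

end potential

end bouquet

/-! ### The Euler genus of a bouquet as a rank over `GF(2)` -/

variable {B : RibbonGraph α}

/-- The variations of the potentials of all edges along the free sides of all edges. -/
def potentialMatrix (B : RibbonGraph α) (φ : B.edges → Corner α → ZMod 2) :
    Matrix B.edges B.edges (ZMod 2) :=
  Matrix.of fun a b => φ b (a.1, false, false) + φ b (a.1, true, false)

section faces

variable {φ : B.edges → Corner α → ZMod 2}

theorem sum_potential_arc (hφ : ∀ b, B.IsPotential b.1 (φ b)) (ψ : B.edges → ZMod 2)
    (x : Corner α) : ∑ b, ψ b * φ b (B.arc x) = ∑ b, ψ b * φ b x :=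
  Finset.sum_congr rfl fun b _ => by rw [(hφ b).arc]

theorem sum_potential_acrossEnd (hφ : ∀ b, B.IsPotential b.1 (φ b)) (ψ : B.edges → ZMod 2)
    {x : Corner α} (hx : x.1 ∈ B.edges) :
    ∑ b, ψ b * φ b x.acrossEnd = ∑ b, ψ b * φ b x + ψ ⟨x.1, hx⟩ := by
  classical
  have : ∀ b : B.edges, ψ b * φ b x.acrossEnd =
      ψ b * φ b x + if b = ⟨x.1, hx⟩ then ψ b else 0 := by
    intro b
    split_ifs with h
    · rw [(hφ b).jump x (by rw [h])]; ring
    · rw [(hφ b).acrossEnd x hx (fun h' => h (Subtype.ext h'.symm)), add_zero]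
  rw [Finset.sum_congr rfl fun b _ => this b, Finset.sum_add_distrib, Finset.sum_ite_eq']
  simp

theorem potentialMatrix_mulVec (ψ : B.edges → ZMod 2) (a : B.edges) :
    (B.potentialMatrix φ).mulVec ψ a =
      ∑ b, ψ b * φ b (a.1, false, false) + ∑ b, ψ b * φ b (a.1, true, false) := by
  rw [← Finset.sum_add_distrib]
  refine Finset.sum_congr rfl fun b _ => ?_
  change (φ b (a.1, false, false) + φ b (a.1, true, false)) * ψ b = _
  ring

/-- The variation of a function of the faces across every edge. -/
def faceVariation (B : RibbonGraph α) :
    (Quot (B.link ∅ Set.univ) → ZMod 2) →ₗ[ZMod 2] (B.edges → ZMod 2) where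
  toFun f e := f (B.cls _ _ (e.1, false, false) e.2) + f (B.cls _ _ (e.1, false, true) e.2)
  map_add' f g := by funext e; simp only [Pi.add_apply]; ring
  map_smul' c f := by funext e; simp [mul_add]

/-- Both ends of an edge separate the same two faces, those of its free sides, so the change across
either end is the variation of `f` at that edge. -/
theorem apply_cls_acrossEnd (f : Quot (B.link ∅ Set.univ) → ZMod 2) {x : Corner α}
    (hx : x.1 ∈ B.edges) : f (B.cls _ _ x.acrossEnd hx) =
      f (B.cls _ _ x hx) + B.faceVariation f ⟨x.1, hx⟩ := by
  have h2 : ∀ u v : ZMod 2, v = u + (u + v) := by decide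
  have h3 : ∀ u v : ZMod 2, u = v + (u + v) := by decide
  obtain ⟨e, i, s⟩ := x
  have h : ∀ s, B.cls ∅ Set.univ (e, true, s) hx = B.cls ∅ Set.univ (e, false, s) hx := fun s =>
    B.cls_alongSide (x := (e, false, s)) hx (Set.mem_univ _)
  change f (B.cls _ _ (e, i, !s) hx) = f (B.cls _ _ (e, i, s) hx) +
    (f (B.cls _ _ (e, false, false) hx) + f (B.cls _ _ (e, false, true) hx))
  cases i <;> cases s <;> simp only [h, Bool.not_true, Bool.not_false]
  · exact h2 _ _
  · exact h3 _ _
  · exact h2 _ _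
  · exact h3 _ _

/-- A face function without variation is preserved by arcs and ends, hence constant on a bouquet. -/
theorem finrank_ker_faceVariation (hB : B.IsBouquet) (hne : B.edges.Nonempty) :
    Module.finrank (ZMod 2) (LinearMap.ker B.faceVariation) = 1 := by
  classical
  obtain ⟨e, he⟩ := hne
  have hone : ∀ u : ZMod 2, u + u = 0 := by decide
  have : LinearMap.ker B.faceVariation = Submodule.span (ZMod 2) {fun _ => 1} := by
    ext f
    rw [LinearMap.mem_ker, Submodule.mem_span_singleton]
    constructor
    · intro hf
      refine ⟨f (B.cls _ _ (e, false, false) he), ?_⟩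
      funext q
      obtain ⟨x, hx⟩ := q
      let g : Corner α → ZMod 2 := fun y => if h : y.1 ∈ B.edges then f (B.cls _ _ y h) else 0
      have hg : ∀ y (h : y.1 ∈ B.edges), g y = f (B.cls _ _ y h) := fun y h => dif_pos h
      have := hB.eq_of_invariant (g := g) (fun y hy => by
          rw [hg _ hy, hg _ (B.arc_mem hy), B.cls_arc])
        (fun y hy => by
          rw [hg _ hy, hg y.acrossEnd hy, apply_cls_acrossEnd f hy, hf]
          simp) (x := (e, false, false)) he hx
      rw [hg (e, false, false) he, hg x hx] at this
      rw [Pi.smul_apply, smul_eq_mul, mul_one]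
      exact this
    · rintro ⟨c, rfl⟩
      funext a
      exact hone _
  rw [this]
  exact finrank_span_singleton fun h => one_ne_zero (congrFun h (B.cls _ _ (e, false, false) he))

/-- If `f` has variation `ψ`, then `f` and `∑ ψ_b φ_b` jump alike at every end, so their sum is
constant on the circle. As `f` is constant along free sides, so is `∑ ψ_b φ_b`, which says that `ψ`
is in the kernel. Conversely, for `ψ` in the kernel, `∑ ψ_b φ_b` descends to the faces and has
variation `ψ`. -/
theorem range_faceVariation (hB : B.IsBouquet) (hφ : ∀ b, B.IsPotential b.1 (φ b)) :
    LinearMap.range B.faceVariation = LinearMap.ker (B.potentialMatrix φ).mulVecLin := by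
  classical
  have hone : ∀ u : ZMod 2, u + u = 0 := by decide
  ext ψ
  rw [LinearMap.mem_range, LinearMap.mem_ker, Matrix.mulVecLin_apply]
  constructor
  · rintro ⟨f, hf⟩
    funext a
    rw [potentialMatrix_mulVec]
    let g : Corner α → ZMod 2 := fun y =>
      (if h : y.1 ∈ B.edges then f (B.cls _ _ y h) else 0) + ∑ b, ψ b * φ b y
    have hg : ∀ y (h : y.1 ∈ B.edges), g y = f (B.cls _ _ y h) + ∑ b, ψ b * φ b y :=
      fun y h => congrArg (· + _) (dif_pos h)
    have h1 := hB.eq_of_invariant (g := g) (fun y hy => by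
        rw [hg _ hy, hg _ (B.arc_mem hy), B.cls_arc, sum_potential_arc hφ])
      (fun y hy => by
        rw [hg _ hy, hg y.acrossEnd hy, apply_cls_acrossEnd f hy, sum_potential_acrossEnd hφ ψ hy,
          hf]
        linear_combination hone (ψ ⟨y.1, hy⟩))
      (x := (a.1, false, false)) (y := (a.1, true, false)) a.2 a.2
    have h2 : B.cls ∅ Set.univ (a.1, true, false) a.2 = B.cls ∅ Set.univ (a.1, false, false) a.2 :=
      B.cls_alongSide (x := (a.1, false, false)) a.2 (Set.mem_univ _)
    rw [hg (a.1, false, false) a.2, hg (a.1, true, false) a.2, h2] at h1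
    rw [add_left_cancel h1]
    exact hone _
  · intro hψ
    let h : Corner α → ZMod 2 := fun x => ∑ b, ψ b * φ b x
    have hz : ∀ u v : ZMod 2, u + v = 0 → u = v := by decide
    have h0 : ∀ a (_ : a ∈ B.edges), h (a, false, false) = h (a, true, false) := by
      intro a ha
      have := congrFun hψ ⟨a, ha⟩
      rw [potentialMatrix_mulVec] at this
      exact hz _ _ this
    -- The kernel condition concerns the free side `false` only; on the side `true` both values are
    -- shifted by the same `ψ a`.
    have hc : ∀ a i (ha : a ∈ B.edges), h (a, i, true) = h (a, i, false) + ψ ⟨a, ha⟩ :=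
      fun a i ha => sum_potential_acrossEnd hφ ψ (x := (a, i, false)) ha
    refine ⟨Quot.lift (fun x => h x.1) ?_, ?_⟩
    · rintro ⟨x, hx⟩ ⟨y, hy⟩ (hh | ⟨hh, _⟩ | ⟨_, hh⟩)
      · obtain rfl : y = B.arc x := hh
        exact (sum_potential_arc hφ ψ x).symm
      · exact hh.elim
      · obtain rfl : y = x.alongSide := hh
        obtain ⟨a, i, s⟩ := x
        change h (a, i, s) = h (a, !i, s)
        cases i <;> cases s <;>
          simp only [hc a _ hx, h0 a hx, Bool.not_false, Bool.not_true]
    · funext a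
      change h (a.1, false, false) + h (a.1, false, true) = ψ a
      rw [hc a.1 false a.2]
      linear_combination hone (h (a.1, false, false))

/-- Rank-nullity for both maps: the common space has dimension `|F| - 1` as a range and `|E| - rank`
as a kernel. -/
theorem numFaces_add_rank (hB : B.IsBouquet) (hne : B.edges.Nonempty)
    (hφ : ∀ b, B.IsPotential b.1 (φ b)) :
    B.numFaces + (B.potentialMatrix φ).rank = B.edges.card + 1 := by
  have := Fintype.ofFinite (Quot (B.link ∅ Set.univ))
  have h1 := B.faceVariation.finrank_range_add_finrank_ker
  have h2 := (B.potentialMatrix φ).mulVecLin.finrank_range_add_finrank_ker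
  rw [finrank_ker_faceVariation hB hne, range_faceVariation hB hφ,
    Module.finrank_fintype_fun_eq_card] at h1
  rw [Module.finrank_fintype_fun_eq_card, Fintype.card_coe] at h2
  rw [numFaces_eq, numClasses, (hB.isolated_eq_zero hne).1, Nat.card_eq_fintype_card, Matrix.rank]
  omega

theorem IsBouquet.numComponents_eq_one (hB : B.IsBouquet) (hne : B.edges.Nonempty) :
    B.numComponents = 1 := by
  obtain ⟨h0, hs⟩ := hB.isolated_eq_zero hne
  obtain ⟨e, he⟩ := hne
  rw [numComponents_eq, numClasses, h0, add_zero, Nat.card_eq_one_iff_unique]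
  refine ⟨⟨?_⟩, ⟨B.cls _ _ (e, false, false) he⟩⟩
  rintro ⟨x, hx⟩ ⟨y, hy⟩
  exact B.cls_mono (le_refl _) (Set.empty_subset _)
    (Subsingleton.elim (B.cls Set.univ ∅ x hx) (B.cls Set.univ ∅ y hy))

/-- The Euler genus of a bouquet is the rank of its intersection form. -/
theorem eulerGenus_eq_rank (hB : B.IsBouquet) (hne : B.edges.Nonempty)
    (hφ : ∀ b, B.IsPotential b.1 (φ b)) : B.eulerGenus = (B.potentialMatrix φ).rank := by
  have h1 := numFaces_add_rank hB hne hφ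
  have h2 : B.numVertices = 1 := hB
  rw [eulerGenus, eulerChar, hB.numComponents_eq_one hne, h2]
  omega

end faces

/-! ### The partial Petrial polynomial of a bouquet -/

variable [DecidableEq α]

theorem IsBouquet.petrial (hB : B.IsBouquet) (A : Finset α) : (B.petrial A).IsBouquet := by
  have h : B.numVertices = 1 := hB
  rw [numVertices_eq] at h
  rw [IsBouquet, numVertices_eq, numClasses_petrial, h]

/-- A twist of `a` replaces the corner at its end `true` by the one across that end. Only the
potential of `a` itself jumps there, so only the diagonal entry changes. -/
theorem potentialMatrix_petrial {φ : B.edges → Corner α → ZMod 2}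
    (hφ : ∀ b, B.IsPotential b.1 (φ b)) (Y : Finset α) :
    (B.petrial Y).potentialMatrix (fun b x => φ b (Corner.swapOn Y x)) =
      B.potentialMatrix φ + B.diagOf Y := by
  refine Matrix.ext (m := B.edges) (n := B.edges) fun a b => ?_
  change φ b (Corner.swapOn Y (a.1, false, false)) + φ b (Corner.swapOn Y (a.1, true, false)) =
    φ b (a.1, false, false) + φ b (a.1, true, false) +
      Matrix.diagonal (fun e : B.edges => if e.1 ∈ Y then 1 else 0) a b
  have h1 : Corner.swapOn Y (a.1, false, false) = (a.1, false, false) := by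
    simp [Corner.swapOn]
  rw [h1, add_assoc]
  congr 1
  by_cases haY : a.1 ∈ Y
  · have h2 : Corner.swapOn Y (a.1, true, false) = Corner.acrossEnd (a.1, true, false) := by
      simp [Corner.swapOn, haY]
    rw [h2]
    by_cases hab : a = b
    · subst hab
      rw [(hφ a).jump _ rfl, Matrix.diagonal_apply_eq, if_pos haY]
    · rw [(hφ b).acrossEnd (a.1, true, false) a.2 (fun h => hab (Subtype.ext h)), Matrix.diagonal_apply_ne _ hab,
        add_zero]
  · rw [Corner.swapOn_of_notMem (x := (a.1, true, false)) haY]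
    by_cases hab : a = b
    · subst hab
      rw [Matrix.diagonal_apply_eq, if_neg haY, add_zero]
    · rw [Matrix.diagonal_apply_ne _ hab, add_zero]

/-- The intersection form of a bouquet is the adjacency matrix of its intersection graph, with
diagonal entries `1` at the twisted loops. -/
theorem potentialMatrix_eq (hB : B.IsBouquet) {φ : B.edges → Corner α → ZMod 2}
    (hφ : ∀ b, B.IsPotential b.1 (φ b)) :
    ∃ S ⊆ B.edges, B.potentialMatrix φ = B.adjI + B.diagOf S := by
  classical
  have hz : ∀ u : ZMod 2, u = if u = 1 then 1 else 0 := by decide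
  have hz2 : ∀ u v : ZMod 2, u + v = if u ≠ v then 1 else 0 := by decide
  refine ⟨(Finset.univ.filter fun a : B.edges => B.potentialMatrix φ a a = 1).map
    (Function.Embedding.subtype _), ?_, ?_⟩
  · intro a ha
    obtain ⟨b, -, rfl⟩ := Finset.mem_map.1 ha
    exact b.2
  · ext a b
    rw [Matrix.add_apply, diagOf, adjI, SimpleGraph.adjMatrix_apply]
    by_cases hab : a = b
    · subst hab
      rw [Matrix.diagonal_apply_eq, if_neg (SimpleGraph.irrefl _), zero_add]
      simpa using hz (B.potentialMatrix φ a a)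
    · have h1 : B.intersectionGraph.Adj a b ↔ φ b (a.1, false, false) ≠ φ b (a.1, true, false) := by
        rw [← (hφ b).interlaced_iff hB a.2 fun h => hab (Subtype.ext h), intersectionGraph,
          SimpleGraph.fromRel_adj]
        exact ⟨fun h => h.2.elim id Interlaced.symm, fun h => ⟨hab, Or.inl h⟩⟩
      rw [Matrix.diagonal_apply_ne _ hab, add_zero]
      simp only [h1]
      exact hz2 _ _

theorem diagOf_add_diagOf (B : RibbonGraph α) (S Y : Finset α) :
    B.diagOf S + B.diagOf Y = B.diagOf (symmDiff S Y) := by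
  rw [diagOf, diagOf, diagOf, Matrix.diagonal_add]
  congr 1
  funext e
  have h2 : (1 + 1 : ZMod 2) = 0 := by decide
  by_cases h : e.1 ∈ S <;> by_cases h' : e.1 ∈ Y <;> simp [Finset.mem_symmDiff, h, h', h2]

/-- The partial Petrial polynomial of a bouquet is determined by its intersection graph. -/
theorem IsBouquet.petrialPoly_eq (hB : B.IsBouquet) :
    B.petrialPoly = ∑ Y ∈ B.edges.powerset, Polynomial.X ^ (B.adjI + B.diagOf Y).rank := by
  rcases B.edges.eq_empty_or_nonempty with hE | hne
  -- Without edges there are no corners: the only vertex-disc is isolated and the surface is a disc,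
  -- of Euler genus `0`.
  · have hV : ∀ A, (B.petrial A).eulerGenus = 0 := by
      intro A
      have h0 : IsEmpty (B.petrial A).Corners := ⟨fun x => by
        have h1 : x.1.1 ∈ B.edges := x.2
        simp [hE] at h1⟩
      have h1 : (B.petrial A).numVertices = 1 := hB.petrial A
      have h2 : ∀ S T, (B.petrial A).numClasses S T = (B.petrial A).isolated := by
        intro S T
        have : IsEmpty (Quot ((B.petrial A).link S T)) := 
          ⟨fun q => Quot.ind (β := fun _ => False) (fun x => h0.elim x) q⟩
        rw [numClasses, Nat.card_of_isEmpty, zero_add]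
      have h3 : (B.petrial A).edges.card = 0 := Finset.card_eq_zero.2 hE
      rw [numVertices_eq, h2] at h1
      rw [eulerGenus, eulerChar, numVertices_eq, numFaces_eq, numComponents_eq, h2, h2, h2, h1, h3]
      norm_num
    have hr : ∀ A, (B.adjI + B.diagOf A).rank = 0 := by
      intro A
      have := (B.adjI + B.diagOf A).rank_le_card_width
      rw [Fintype.card_coe] at this
      exact Nat.le_zero.1 (this.trans (Finset.card_eq_zero.2 hE).le)
    simp only [petrialPoly, hV, hr]
    rfl
  · choose φ hφ using fun b : B.edges => hB.exists_isPotential b.2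
    obtain ⟨S, hS, hM⟩ := potentialMatrix_eq hB hφ
    have key : ∀ Y, (B.petrial Y).eulerGenus.toNat = (B.adjI + B.diagOf (symmDiff S Y)).rank := by
      intro Y
      rw [eulerGenus_eq_rank (hB.petrial Y) hne (fun b => (hφ b).petrial Y), Int.toNat_natCast,
        potentialMatrix_petrial hφ, hM, add_assoc, diagOf_add_diagOf]
      rfl
    have hsub : ∀ Y ∈ B.edges.powerset, symmDiff S Y ∈ B.edges.powerset := by
      intro Y hY
      rw [Finset.mem_powerset] at hY ⊢
      intro e he
      rcases Finset.mem_symmDiff.1 he with h | h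
      · exact hS h.1
      · exact hY h.1
    rw [petrialPoly]
    -- `S` is the support of the initial diagonal, and `Y ↦ symmDiff S Y` is an involution of the
    -- subsets of `B.edges`.
    refine Finset.sum_nbij' (symmDiff S) (symmDiff S) hsub hsub ?_ ?_ ?_
    · intro Y _; exact symmDiff_symmDiff_cancel_left S Y
    · intro Y _; exact symmDiff_symmDiff_cancel_left S Y
    · intro Y _; rw [key]

end RibbonGraph

/-! ### Assembling the two formulas -/

theorem Finset.sum_powerset_eq_sum_sum {α M : Type*} [DecidableEq α] [AddCommMonoid M] {E T : Finset α} (h : T ⊆ E)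
    (f : Finset α → M) :
    ∑ A ∈ E.powerset, f A = ∑ X ∈ T.powerset, ∑ Y ∈ (E \ T).powerset, f (X ∪ Y) := by
  rw [← Finset.sum_product']
  refine Finset.sum_nbij' (fun A => (A ∩ T, A \ T)) (fun p => p.1 ∪ p.2) ?_ ?_ ?_ ?_ ?_
  · intro A hA
    rw [Finset.mem_powerset] at hA
    simp only [Finset.mem_product, Finset.mem_powerset]
    exact ⟨Finset.inter_subset_right, Finset.sdiff_subset_sdiff hA (le_refl _)⟩
  · rintro ⟨X, Y⟩ hp
    simp only [Finset.mem_product, Finset.mem_powerset] at hp ⊢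
    exact Finset.union_subset (hp.1.trans h) (hp.2.trans Finset.sdiff_subset)
  · intro A _
    simp only
    rw [Finset.union_comm]; exact Finset.sdiff_union_inter A T
  · rintro ⟨X, Y⟩ hp
    simp only [Finset.mem_product, Finset.mem_powerset] at hp
    ext e
    · have h1 := @hp.1 e
      have h2 := @hp.2 e
      simp only [Finset.mem_sdiff] at h2
      simp only [Finset.mem_inter, Finset.mem_union]
      tauto
    · have h1 := @hp.1 e
      have h2 := @hp.2 e
      simp only [Finset.mem_sdiff] at h2
      simp only [Finset.mem_sdiff, Finset.mem_union]
      tauto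
  · intro A _
    simp only
    rw [Finset.union_comm, Finset.sdiff_union_inter]

theorem theorem2 {α : Type*} [DecidableEq α] (G : RibbonGraph α) (hG : G.Connected)
    (hn : 2 ≤ G.numVertices) (T : Finset α) (hT : G.IsSpanningTree T)
    (l : List α) (hl : l.Nodup) (hlT : l.toFinset = T) :
    T.powerset.card = 2 ^ (G.numVertices - 1) ∧
    (∀ X ∈ T.powerset, ((G.petrial X).aux l).IsBouquet ∧
      ((G.petrial X).aux l).edges = G.edges \ T) ∧
    G.petrialPoly = ∑ X ∈ T.powerset, ((G.petrial X).aux l).petrialPoly ∧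
    G.petrialPoly = ∑ X ∈ T.powerset, ∑ Y ∈ (G.edges \ T).powerset,
      Polynomial.X ^
        (((G.petrial X).aux l).adjI + ((G.petrial X).aux l).diagOf Y).rank := by
  subst hlT
  have hE : ∀ X, ((G.petrial X).aux l).edges = G.edges \ l.toFinset := fun X =>
    RibbonGraph.edges_aux _ _
  have hB : ∀ X, ((G.petrial X).aux l).IsBouquet := fun X => ((hT.spans.petrial X).aux hl).1
  have hP : G.petrialPoly = ∑ X ∈ l.toFinset.powerset, ((G.petrial X).aux l).petrialPoly := by
    rw [RibbonGraph.petrialPoly, Finset.sum_powerset_eq_sum_sum hT.subset]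
    refine Finset.sum_congr rfl fun X hX => ?_
    rw [RibbonGraph.petrialPoly, hE]
    refine Finset.sum_congr rfl fun Y hY => ?_
    rw [Finset.mem_powerset] at hX hY
    have hYl : ∀ e ∈ l, e ∉ Y := fun e he heY =>
      (Finset.mem_sdiff.1 (hY heY)).2 (List.mem_toFinset.2 he)
    have hXY : Disjoint X Y := Finset.disjoint_left.2 fun e he =>
      hYl e (List.mem_toFinset.1 (hX he))
    -- Twisting `Y` after contracting is twisting `X ∪ Y` before; the tree still spans that Petrial,
    -- so contracting it preserves the Euler genus.
    rw [← RibbonGraph.aux_petrial _ l hYl, G.petrial_petrial hXY,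
      ((hT.spans.petrial (X ∪ Y)).aux hl).2]
  refine ⟨?_, fun X _ => ⟨hB X, hE X⟩, hP, ?_⟩
  · rw [Finset.card_powerset, hT.numVertices_eq, Nat.add_sub_cancel]
  · rw [hP]
    refine Finset.sum_congr rfl fun X _ => ?_
    rw [(hB X).petrialPoly_eq]
    exact Finset.sum_congr (congrArg Finset.powerset (hE X)) fun _ _ => rfl
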